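/- For $0<p\le\infty$ and $n\in\mathbb N=\{1,2,\dots\}$ let $\ell_p^n(\mathbb C)$ be $\mathbb C^n$ with the (quasi-)norm $\|x\|_p=\bigl(\sum_{i=1}^n|x_i|^p\bigr)^{1/p}$ if $p<\infty$ and $\|x\|_\infty=\max_{1\le i\le n}|x_i|$, and let $B_p=\{x\in\mathbb C^n:\|x\|_p\le1\}$ be its unit ball. For $k\in\mathbb N$, the $k$-th (dyadic) entropy number of the identity $id:\ell_p^n(\mathbb C)\to\ell_q^n(\mathbb C)$ is $$e_k(id:\ell_p^n(\mathbb C)\to\ell_q^n(\mathbb C))=\inf\Bigl\{r>0:\ \exists\,y_1,\dots,y_{2^{k-1}}\in\mathbb C^n\ \text{with}\ B_p\subset\bigcup_{j=1}^{2^{k-1}}(y_j+rB_q)\Bigr\}.$$ Theorem. Let $0<p,q\le\infty$, with the convention $1/\infty=0$. a) If $p\le q$, then for all $n,k\in\mathbb N$ $$e_k(id:\ell_p^n(\mathbb C)\to\ell_q^n(\mathbb C))\sim\begin{cases}1&\text{if }1\le k\le\log_2(2n),\\ \Bigl(\dfrac{\log_2(1+2n/k)}{k}\Bigr)^{\frac1p-\frac1q}&\text{if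 }\log_2(2n)\le k\le 2n,\\ 2^{-\frac{k-1}{2n}}\,n^{\frac1q-\frac1p}&\text{if }2n\le k.\end{cases}$$ b) If $q\le p$, then for all $n,k\in\mathbb N$ $$e_k(id:\ell_p^n(\mathbb C)\to\ell_q^n(\mathbb C))\sim 2^{-\frac{k-1}{2n}}\,n^{\frac1q-\frac1p}.$$ Here $A\sim B$ means that $c\,B\le A\le C\,B$ with constants $c,C>0$ that may depend on $p$ and $q$ but not on $k$ and $n$. -/

import Mathlib

open scoped ENNReal Pointwise

/-- The closed unit ball `B_X = {x ∈ X : ‖x‖ ≤ 1}` of a space with a (quasi-)norm. -/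
def unitBall (X : Type*) [Norm X] : Set X := {x | ‖x‖ ≤ 1}

/-- The `k`-th dyadic entropy number (`k ≥ 1`) of a linear operator `T : X → Y`: the infimum of
all `r > 0` such that `T(B_X)` is covered by `2^(k-1)` translates of `r B_Y`.
Only the functional `‖·‖` is used, so that quasi-norms are allowed. -/
noncomputable def entropyNumber {𝕜 X Y : Type*} [RCLike 𝕜]
    [AddCommGroup X] [Module 𝕜 X] [Norm X] [AddCommGroup Y] [Module 𝕜 Y] [Norm Y]
    (k : ℕ) (T : X →ₗ[𝕜] Y) : ℝ :=
  sInf {r : ℝ | 0 < r ∧ ∃ y : Fin (2 ^ (k - 1)) → Y,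
    T '' unitBall X ⊆ ⋃ j, (y j +ᵥ ((r : 𝕜) • unitBall Y))}

/-- The space `ℓ_p^n(ℂ)`, i.e. `ℂ^n` with `‖x‖_p = (∑ |x_i|^p)^(1/p)` for `0 < p < ∞` and
`‖x‖_∞ = max |x_i|`. Mathlib's `‖·‖` on `PiLp` is this (quasi-)norm for every `0 < p ≤ ∞`. -/
abbrev EllC (p : ℝ≥0∞) (n : ℕ) : Type := PiLp p (fun _ : Fin n => ℂ)

/-- The identity `id : ℓ_p^n(ℂ) → ℓ_q^n(ℂ)`. -/
def idC (p q : ℝ≥0∞) (n : ℕ) : EllC p n →ₗ[ℂ] EllC q n :=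
  (WithLp.linearEquiv q ℂ (Fin n → ℂ)).symm.toLinearMap ∘ₗ
    (WithLp.linearEquiv p ℂ (Fin n → ℂ)).toLinearMap

/-!
Upper bounds for `p ≤ q`: rounding the real and imaginary parts of the coordinates of a point of the
unit ball of `ℓ_p^n` to the grid of mesh `m ^ (-1 / p)` changes it by at most `m ^ (1 / q - 1 / p)`
in `ℓ_q^n`, since in each coordinate the error exceeds neither the mesh nor the coordinate itself.
An exponential moment bound shows that only `exp (O (m * log (1 + n / m)))` grid points occur, and
`m ≈ k / log (1 + 2 * n / k)` makes this at most `2 ^ (k - 1)`. For larger `k`, and any `p` and `q`,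
the ball is covered by about `A ^ n` cubes of side `n ^ (-1 / p)`, which are then subdivided.

Lower bounds: the unit balls of `ℓ_p^n` and `ℓ_q^n` have, up to factors `A ^ n`, the volume of cubes
of side `n ^ (-1 / p)` and `n ^ (-1 / q)`, so counting volume gives the rate for large `k`. For `k`
small compared to `n`, words of length `m` over an alphabet of size about `n / k` are encoded by
normalized indicators, with one coordinate for each position and letter. These are points of the
unit ball, and few of them lie within a small multiple of `m ^ (1 / q - 1 / p)` of a given one. For
`2 ^ (k - 1) ≤ n` the origin and the unit vectors suffice.
-/

open WithLp (toLp)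

section QuasiNorm

variable {p q : ℝ≥0∞} {ι E F : Type*} [Fintype ι] [SeminormedAddCommGroup E]
  [SeminormedAddCommGroup F]

theorem toReal_one_div (p : ℝ≥0∞) : (1 / p).toReal = p.toReal⁻¹ := by
  rw [one_div, ENNReal.toReal_inv]

theorem toReal_one_div_anti (hp : 0 < p) (hpq : p ≤ q) : (1 / q).toReal ≤ (1 / p).toReal := by
  refine ENNReal.toReal_mono (by simp [hp.ne']) ?_
  gcongr

theorem rpow_toReal_one_div_rpow {c : ℝ} (hp : 0 < p) (hp' : p ≠ ∞) (hc : 0 ≤ c) :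
    (c ^ (1 / p).toReal) ^ p.toReal = c := by
  rw [toReal_one_div, Real.rpow_inv_rpow hc (ENNReal.toReal_pos hp.ne' hp').ne']

theorem norm_toLp_top (x : ι → E) : ‖toLp ∞ x‖ = ‖x‖ := PiLp.norm_toLp x

theorem norm_toLp_le_iff (hp : 0 < p) (hp' : p ≠ ∞) {x : ι → E} {r : ℝ} (hr : 0 ≤ r) :
    ‖toLp p x‖ ≤ r ↔ ∑ i, ‖x i‖ ^ p.toReal ≤ r ^ p.toReal := by
  have hp₀ : 0 < p.toReal := ENNReal.toReal_pos hp.ne' hp'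
  rw [PiLp.norm_eq_sum hp₀, one_div, Real.rpow_inv_le_iff_of_pos (by positivity) hr hp₀]

theorem norm_toLp_nonneg (p : ℝ≥0∞) (x : ι → E) : 0 ≤ ‖toLp p x‖ := by
  rcases p.trichotomy with rfl | rfl | hp
  · rw [PiLp.norm_eq_card]
    positivity
  · rw [norm_toLp_top]
    positivity
  · rw [PiLp.norm_eq_sum hp]
    positivity

theorem norm_toLp_rpow (hp : 0 < p) (hp' : p ≠ ∞) (x : ι → E) :
    ‖toLp p x‖ ^ p.toReal = ∑ i, ‖x i‖ ^ p.toReal := by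
  have hp₀ : 0 < p.toReal := ENNReal.toReal_pos hp.ne' hp'
  rw [PiLp.norm_eq_sum hp₀, one_div, Real.rpow_inv_rpow (by positivity) hp₀.ne']

theorem norm_toLp_mono (hp : 0 < p) {x : ι → E} {y : ι → F} (h : ∀ i, ‖x i‖ ≤ ‖y i‖) :
    ‖toLp p x‖ ≤ ‖toLp p y‖ := by
  rcases eq_or_ne p ∞ with rfl | hp'
  · rw [norm_toLp_top, norm_toLp_top]
    exact (pi_norm_le_iff_of_nonneg (norm_nonneg y)).2 fun i => (h i).trans (norm_le_pi_norm y i)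
  · rw [norm_toLp_le_iff hp hp' (norm_toLp_nonneg p y), norm_toLp_rpow hp hp']
    gcongr with i
    exact h i

theorem norm_le_norm_toLp (hp : 0 < p) (x : ι → E) : ‖x‖ ≤ ‖toLp p x‖ := by
  rcases eq_or_ne p ∞ with rfl | hp'
  · rw [norm_toLp_top]
  · refine (pi_norm_le_iff_of_nonneg (norm_toLp_nonneg p x)).2 fun i => ?_
    rw [← Real.rpow_le_rpow_iff (norm_nonneg _) (norm_toLp_nonneg p x)
      (ENNReal.toReal_pos hp.ne' hp'), norm_toLp_rpow hp hp']
    exact Finset.single_le_sum (f := fun i => ‖x i‖ ^ p.toReal) (fun i _ => by positivity)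
      (Finset.mem_univ i)

theorem norm_toLp_le_card_rpow_mul (hp : 0 < p) (x : ι → E) :
    ‖toLp p x‖ ≤ (Fintype.card ι : ℝ) ^ (1 / p).toReal * ‖x‖ := by
  rcases eq_or_ne p ∞ with rfl | hp'
  · simp
  · rw [norm_toLp_le_iff hp hp' (by positivity), Real.mul_rpow (by positivity) (by positivity),
      rpow_toReal_one_div_rpow hp hp' (by positivity)]
    calc ∑ i, ‖x i‖ ^ p.toReal ≤ ∑ _i : ι, ‖x‖ ^ p.toReal := by
          gcongr with i
          exact norm_le_pi_norm x i
      _ = Fintype.card ι * ‖x‖ ^ p.toReal := by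
          rw [Finset.sum_const, nsmul_eq_mul, Finset.card_univ]

theorem norm_toLp_indicator (hp : 0 < p) {S : Finset ι} (hS : S.Nonempty) (c : E) :
    ‖toLp p ((S : Set ι).indicator fun _ => c)‖ = (S.card : ℝ) ^ (1 / p).toReal * ‖c‖ := by
  classical
  rcases eq_or_ne p ∞ with rfl | hp'
  · rw [norm_toLp_top, ENNReal.div_top, ENNReal.toReal_zero, Real.rpow_zero, one_mul]
    obtain ⟨i, hi⟩ := hS
    refine le_antisymm ((pi_norm_le_iff_of_nonneg (norm_nonneg c)).2 fun j =>
      norm_indicator_le_norm_self (fun _ => c) j) ?_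
    simpa [hi] using norm_le_pi_norm ((S : Set ι).indicator fun _ => c) i
  · have hp₀ : 0 < p.toReal := ENNReal.toReal_pos hp.ne' hp'
    rw [← Real.rpow_left_inj (norm_toLp_nonneg p _) (by positivity) hp₀.ne',
      norm_toLp_rpow hp hp', Real.mul_rpow (by positivity) (by positivity),
      rpow_toReal_one_div_rpow hp hp' (by positivity)]
    have pointwise (i : ι) : ‖(S : Set ι).indicator (fun _ => c) i‖ ^ p.toReal
        = if i ∈ S then ‖c‖ ^ p.toReal else 0 := by
      split_ifs with hi <;> simp [hi, hp₀.ne']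
    simp only [pointwise, Finset.sum_ite_mem, Finset.univ_inter, Finset.sum_const, nsmul_eq_mul]

theorem norm_toLp_smul {𝕜 : Type*} [NormedField 𝕜] [NormedSpace 𝕜 E] (hp : 0 < p) (c : 𝕜)
    (x : ι → E) : ‖toLp p (c • x)‖ = ‖c‖ * ‖toLp p x‖ := by
  rcases eq_or_ne p ∞ with rfl | hp'
  · rw [norm_toLp_top, norm_toLp_top, norm_smul]
  · have hp₀ : 0 < p.toReal := ENNReal.toReal_pos hp.ne' hp'
    rw [← Real.rpow_left_inj (norm_toLp_nonneg p _)
      (mul_nonneg (norm_nonneg c) (norm_toLp_nonneg p x)) hp₀.ne',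
      Real.mul_rpow (norm_nonneg c) (norm_toLp_nonneg p x), norm_toLp_rpow hp hp',
      norm_toLp_rpow hp hp', Finset.mul_sum]
    simp only [Pi.smul_apply, norm_smul, Real.mul_rpow (norm_nonneg c) (norm_nonneg _)]

theorem norm_toLp_sub_le (hp : 0 < p) {x y : ι → E} {r : ℝ} (hx : ‖toLp p x‖ ≤ r)
    (hy : ‖toLp p y‖ ≤ r) : ‖toLp p (x - y)‖ ≤ 2 * 2 ^ (1 / p).toReal * r := by
  have hr : 0 ≤ r := (norm_toLp_nonneg p x).trans hx
  rcases eq_or_ne p ∞ with rfl | hp'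
  · rw [norm_toLp_top] at *
    rw [ENNReal.div_top, ENNReal.toReal_zero, Real.rpow_zero]
    linarith [norm_sub_le x y]
  · rw [norm_toLp_le_iff hp hp' hr] at hx hy
    rw [norm_toLp_le_iff hp hp' (by positivity), Real.mul_rpow (by positivity) hr,
      Real.mul_rpow (by positivity) (by positivity),
      rpow_toReal_one_div_rpow hp hp' (by positivity)]
    have pointwise (i : ι) :
        ‖x i - y i‖ ^ p.toReal ≤ 2 ^ p.toReal * (‖x i‖ ^ p.toReal + ‖y i‖ ^ p.toReal) := by
      calc ‖x i - y i‖ ^ p.toReal ≤ (2 * max ‖x i‖ ‖y i‖) ^ p.toReal := by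
            gcongr
            linarith [norm_sub_le (x i) (y i), le_max_left ‖x i‖ ‖y i‖, le_max_right ‖x i‖ ‖y i‖]
        _ = 2 ^ p.toReal * max ‖x i‖ ‖y i‖ ^ p.toReal := by
            rw [Real.mul_rpow (by positivity) (by positivity)]
        _ ≤ 2 ^ p.toReal * (‖x i‖ ^ p.toReal + ‖y i‖ ^ p.toReal) := by
            gcongr
            rcases max_choice ‖x i‖ ‖y i‖ with h | h <;> rw [h]
            · exact le_add_of_nonneg_right (by positivity)
            · exact le_add_of_nonneg_left (by positivity)
    calc ∑ i, ‖(x - y) i‖ ^ p.toReal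
        ≤ ∑ i, 2 ^ p.toReal * (‖x i‖ ^ p.toReal + ‖y i‖ ^ p.toReal) :=
          Finset.sum_le_sum fun i _ => pointwise i
      _ = 2 ^ p.toReal * (∑ i, ‖x i‖ ^ p.toReal + ∑ i, ‖y i‖ ^ p.toReal) := by
          rw [← Finset.mul_sum, Finset.sum_add_distrib]
      _ ≤ 2 ^ p.toReal * (r ^ p.toReal + r ^ p.toReal) := by gcongr
      _ = 2 ^ p.toReal * 2 * r ^ p.toReal := by ring

theorem norm_toLp_le_of_norm_apply_le (hp : 0 < p) (hpq : p ≤ q) {x : ι → E} {m : ℝ}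
    (hm : 0 < m) (hx : ‖toLp p x‖ ≤ 1) (hxm : ‖x‖ ≤ m ^ (-(1 / p).toReal)) :
    ‖toLp q x‖ ≤ m ^ ((1 / q).toReal - (1 / p).toReal) := by
  rcases eq_or_ne q ∞ with rfl | hq'
  · simpa [norm_toLp_top] using hxm
  · have hp' : p ≠ ∞ := ne_top_of_le_ne_top hq' hpq
    have hq : 0 < q := hp.trans_le hpq
    have hp₀ : 0 < p.toReal := ENNReal.toReal_pos hp.ne' hp'
    have hq₀ : 0 < q.toReal := ENNReal.toReal_pos hq.ne' hq'
    have hpq₀ : 0 ≤ q.toReal - p.toReal := sub_nonneg.2 (ENNReal.toReal_mono hq' hpq)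
    rw [norm_toLp_le_iff hp hp' zero_le_one, Real.one_rpow] at hx
    rw [norm_toLp_le_iff hq hq' (by positivity)]
    calc ∑ i, ‖x i‖ ^ q.toReal
        = ∑ i, ‖x i‖ ^ (q.toReal - p.toReal) * ‖x i‖ ^ p.toReal := by
          simp only [← Real.rpow_add_of_nonneg (norm_nonneg _) hpq₀ hp₀.le, sub_add_cancel]
      _ ≤ ∑ i, (m ^ (-(1 / p).toReal)) ^ (q.toReal - p.toReal) * ‖x i‖ ^ p.toReal := by
          gcongr with i
          exact (norm_le_pi_norm x i).trans hxm
      _ ≤ (m ^ (-(1 / p).toReal)) ^ (q.toReal - p.toReal) := by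
          rw [← Finset.mul_sum]
          exact mul_le_of_le_one_right (by positivity) hx
      _ = (m ^ ((1 / q).toReal - (1 / p).toReal)) ^ q.toReal := by
          rw [← Real.rpow_mul hm.le, ← Real.rpow_mul hm.le, toReal_one_div, toReal_one_div]
          congr 1
          field_simp
          ring

theorem norm_toLp_le_one_of_le (hp : 0 < p) (hpq : p ≤ q) {x : ι → E} (hx : ‖toLp p x‖ ≤ 1) :
    ‖toLp q x‖ ≤ 1 := by
  have hx' : ‖x‖ ≤ 1 := (norm_le_norm_toLp hp x).trans hx
  simpa using norm_toLp_le_of_norm_apply_le hp hpq one_pos hx (by simpa using hx')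

theorem norm_toLp_le_card_rpow_mul_norm_toLp (hq : 0 < q) (hqp : q ≤ p) (x : ι → E) :
    ‖toLp q x‖ ≤ (Fintype.card ι : ℝ) ^ ((1 / q).toReal - (1 / p).toReal) * ‖toLp p x‖ := by
  rcases eq_or_ne p ∞ with rfl | hp'
  · simpa [norm_toLp_top] using norm_toLp_le_card_rpow_mul hq x
  · have hp : 0 < p := hq.trans_le hqp
    have hq' : q ≠ ∞ := ne_top_of_le_ne_top hp' hqp
    have hp₀ : 0 < p.toReal := ENNReal.toReal_pos hp.ne' hp'
    have hq₀ : 0 < q.toReal := ENNReal.toReal_pos hq.ne' hq'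
    have one_le : 1 ≤ p.toReal / q.toReal := (one_le_div hq₀).2 (ENNReal.toReal_mono hp' hqp)
    have power_mean := Real.rpow_sum_le_const_mul_sum_rpow_of_nonneg (Finset.univ : Finset ι)
      (f := fun i => ‖x i‖ ^ q.toReal) one_le fun i _ => by positivity
    simp only [← Real.rpow_mul (norm_nonneg _), mul_div_cancel₀ _ hq₀.ne', Finset.card_univ,
      ← norm_toLp_rpow hp hp', ← norm_toLp_rpow hq hq'] at power_mean
    rw [← Real.rpow_mul (norm_toLp_nonneg q x), mul_div_cancel₀ _ hq₀.ne'] at power_mean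
    have hp_nonneg : 0 ≤ ‖toLp p x‖ := norm_toLp_nonneg p x
    rw [← Real.rpow_le_rpow_iff (norm_toLp_nonneg q x) (by positivity) hp₀,
      Real.mul_rpow (by positivity) hp_nonneg, ← Real.rpow_mul (by positivity), toReal_one_div,
      toReal_one_div]
    convert power_mean using 3
    field_simp

end QuasiNorm

section EntropyNumber

variable {𝕜 X Y : Type*} [RCLike 𝕜] [AddCommGroup X] [Module 𝕜 X] [Norm X]
  [AddCommGroup Y] [Module 𝕜 Y] [Norm Y] [NormSMulClass 𝕜 Y] {k l : ℕ} {T : X →ₗ[𝕜] Y} {r b : ℝ}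

theorem mem_vadd_smul_unitBall_iff (hr : 0 < r) {x y : Y} :
    x ∈ y +ᵥ ((r : 𝕜) • unitBall Y) ↔ ‖x - y‖ ≤ r := by
  have hr' : (r : 𝕜) ≠ 0 := RCLike.ofReal_ne_zero.2 hr.ne'
  rw [Set.mem_vadd_set_iff_neg_vadd_mem, Set.mem_smul_set_iff_inv_smul_mem₀ hr', vadd_eq_add,
    neg_add_eq_sub, unitBall, Set.mem_ofPred_eq, norm_smul, norm_inv, RCLike.norm_ofReal,
    abs_of_pos hr, inv_mul_le_one₀ hr]

theorem entropyNumber_eq_sInf : entropyNumber k T = sInf {r : ℝ | 0 < r ∧ ∃ Z : Finset Y,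
    Z.card ≤ 2 ^ (k - 1) ∧ ∀ x, ‖x‖ ≤ 1 → ∃ z ∈ Z, ‖T x - z‖ ≤ r} := by
  classical
  have covered_iff {r : ℝ} (hr : 0 < r) (y : Fin (2 ^ (k - 1)) → Y) :
      T '' unitBall X ⊆ ⋃ j, (y j +ᵥ ((r : 𝕜) • unitBall Y)) ↔
        ∀ x, ‖x‖ ≤ 1 → ∃ j, ‖T x - y j‖ ≤ r := by
    simp only [Set.subset_def, Set.forall_mem_image, Set.mem_iUnion,
      mem_vadd_smul_unitBall_iff hr]
    rfl
  rw [entropyNumber]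
  congr! 3 with r
  refine and_congr_right fun hr => ?_
  simp only [covered_iff hr]
  constructor
  · rintro ⟨y, hy⟩
    refine ⟨Finset.univ.image y, Finset.card_image_le.trans (by simp), fun x hx => ?_⟩
    simpa using hy x hx
  · rintro ⟨Z, hZ, hcover⟩
    obtain ⟨e⟩ : Nonempty (Z ↪ Fin (2 ^ (k - 1))) :=
      Function.Embedding.nonempty_of_card_le (by simpa using hZ)
    refine ⟨Function.extend e Subtype.val 0, fun x hx => ?_⟩
    obtain ⟨z, hz, hxz⟩ := hcover x hx
    exact ⟨e ⟨z, hz⟩, by rwa [e.injective.extend_apply]⟩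

theorem entropyNumber_le_of_cover (hr : 0 < r) {Z : Finset Y} (hZ : Z.card ≤ 2 ^ (k - 1))
    (hcover : ∀ x, ‖x‖ ≤ 1 → ∃ z ∈ Z, ‖T x - z‖ ≤ r) : entropyNumber k T ≤ r := by
  rw [entropyNumber_eq_sInf]
  exact csInf_le ⟨0, fun _ h => h.1.le⟩ ⟨hr, Z, hZ, hcover⟩

theorem le_entropyNumber (hT : ∃ R : ℝ, ∀ x, ‖x‖ ≤ 1 → ‖T x‖ ≤ R)
    (h : ∀ r : ℝ, 0 < r → ∀ Z : Finset Y, Z.card ≤ 2 ^ (k - 1) →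
      (∀ x, ‖x‖ ≤ 1 → ∃ z ∈ Z, ‖T x - z‖ ≤ r) → b ≤ r) : b ≤ entropyNumber k T := by
  rw [entropyNumber_eq_sInf]
  refine le_csInf ?_ fun r ⟨hr, Z, hZ, hcover⟩ => h r hr Z hZ hcover
  obtain ⟨R, hR⟩ := hT
  exact ⟨max R 1, by simp, {0}, by simpa using Nat.one_le_two_pow, fun x hx =>
    ⟨0, by simp, by simpa using .inl (hR x hx)⟩⟩

theorem entropyNumber_anti (hT : ∃ R : ℝ, ∀ x, ‖x‖ ≤ 1 → ‖T x‖ ≤ R) (hkl : k ≤ l) :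
    entropyNumber l T ≤ entropyNumber k T :=
  le_entropyNumber hT fun _ hr _ hZ hcover =>
    entropyNumber_le_of_cover hr (hZ.trans (by gcongr; norm_num)) hcover

end EntropyNumber

section IdC

variable {p q : ℝ≥0∞} {n k l : ℕ} {r b : ℝ}

theorem normSMulClass_piLp {𝕜 ι E : Type*} [Fintype ι] [SeminormedAddCommGroup E] [NormedField 𝕜]
    [NormedSpace 𝕜 E] (hq : 0 < q) : NormSMulClass 𝕜 (PiLp q fun _ : ι => E) :=
  ⟨fun c x => norm_toLp_smul hq c x.ofLp⟩

theorem exists_norm_idC_le (hp : 0 < p) (hq : 0 < q) (n : ℕ) :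
    ∃ R : ℝ, ∀ x, ‖x‖ ≤ 1 → ‖idC p q n x‖ ≤ R := by
  refine ⟨(n : ℝ) ^ (1 / q).toReal, fun x hx => ?_⟩
  calc ‖toLp q x.ofLp‖ ≤ (n : ℝ) ^ (1 / q).toReal * ‖x.ofLp‖ := by
        simpa using norm_toLp_le_card_rpow_mul hq x.ofLp
    _ ≤ (n : ℝ) ^ (1 / q).toReal :=
        mul_le_of_le_one_right (by positivity) ((norm_le_norm_toLp hp x.ofLp).trans hx)

theorem entropyNumber_idC_le_of_cover (hq : 0 < q) (hr : 0 < r) {Z : Finset (Fin n → ℂ)}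
    (hZ : Z.card ≤ 2 ^ (k - 1))
    (hcover : ∀ x : Fin n → ℂ, ‖toLp p x‖ ≤ 1 → ∃ z ∈ Z, ‖toLp q (x - z)‖ ≤ r) :
    entropyNumber k (idC p q n) ≤ r := by
  have := normSMulClass_piLp (𝕜 := ℂ) (ι := Fin n) (E := ℂ) hq
  refine entropyNumber_le_of_cover hr (Z := Z.map (WithLp.equiv q _).symm.toEmbedding)
    (by rwa [Finset.card_map]) fun x hx => ?_
  obtain ⟨z, hz, hxz⟩ := hcover x.ofLp hx
  exact ⟨toLp q z, Finset.mem_map_of_mem _ hz, hxz⟩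

theorem le_entropyNumber_idC (hp : 0 < p) (hq : 0 < q)
    (h : ∀ r : ℝ, 0 < r → ∀ Z : Finset (Fin n → ℂ), Z.card ≤ 2 ^ (k - 1) →
      (∀ x : Fin n → ℂ, ‖toLp p x‖ ≤ 1 → ∃ z ∈ Z, ‖toLp q (x - z)‖ ≤ r) → b ≤ r) :
    b ≤ entropyNumber k (idC p q n) := by
  have := normSMulClass_piLp (𝕜 := ℂ) (ι := Fin n) (E := ℂ) hq
  refine le_entropyNumber (exists_norm_idC_le hp hq n) fun r hr Z hZ hcover =>
    h r hr (Z.map (WithLp.equiv q _).toEmbedding) (by rwa [Finset.card_map]) fun x hx => ?_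
  obtain ⟨z, hz, hxz⟩ := hcover (toLp p x) hx
  exact ⟨z.ofLp, Finset.mem_map_of_mem _ hz, hxz⟩

theorem entropyNumber_idC_anti (hp : 0 < p) (hq : 0 < q) (hkl : k ≤ l) :
    entropyNumber l (idC p q n) ≤ entropyNumber k (idC p q n) := by
  have := normSMulClass_piLp (𝕜 := ℂ) (ι := Fin n) (E := ℂ) hq
  exact entropyNumber_anti (exists_norm_idC_le hp hq n) hkl

theorem entropyNumber_idC_le_of_norm_le (hq : 0 < q) (hr : 0 < r)
    (h : ∀ x : Fin n → ℂ, ‖toLp p x‖ ≤ 1 → ‖toLp q x‖ ≤ r) : entropyNumber k (idC p q n) ≤ r :=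
  entropyNumber_idC_le_of_cover hq hr (Z := {0}) (by simpa using Nat.one_le_two_pow)
    fun x hx => ⟨0, by simp, by simpa using h x hx⟩

theorem le_entropyNumber_idC_of_card_near_le (hp : 0 < p) (hq : 0 < q) {V : Type*} [Fintype V]
    {x : V → Fin n → ℂ} {N : ℕ} {δ : ℝ} (hx : ∀ v, ‖toLp p (x v)‖ ≤ 1)
    (hnear : ∀ v, {w | ‖toLp q (x v - x w)‖ < δ}.ncard ≤ N)
    (hcard : 2 ^ (k - 1) * N < Fintype.card V) :
    (2 * 2 ^ (1 / q).toReal)⁻¹ * δ ≤ entropyNumber k (idC p q n) := by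
  classical
  refine le_entropyNumber_idC hp hq fun r _ Z hZ hcover => ?_
  choose z hz hxz using fun v => hcover (x v) (hx v)
  obtain ⟨c, -, hc⟩ := Finset.exists_lt_card_fiber_of_mul_lt_card_of_maps_to
    (s := Finset.univ) (fun v _ => hz v) ((Nat.mul_le_mul_right N hZ).trans_lt hcard)
  obtain ⟨v, hv⟩ := Finset.card_pos.1 (N.zero_le.trans_lt hc)
  obtain ⟨w, hw, hδ⟩ : ∃ w, z w = z v ∧ δ ≤ ‖toLp q (x v - x w)‖ := by
    by_contra! hclose
    refine (hnear v).not_gt (hc.trans_le ?_)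
    rw [← Set.ncard_coe_finset]
    refine Set.ncard_le_ncard (fun w hw => hclose w ?_)
    rw [(Finset.mem_filter.1 hw).2, (Finset.mem_filter.1 hv).2]
  rw [inv_mul_le_iff₀ (by positivity)]
  calc δ ≤ ‖toLp q ((x v - z v) - (x w - z v))‖ := by rwa [sub_sub_sub_cancel_right]
    _ ≤ 2 * 2 ^ (1 / q).toReal * r := norm_toLp_sub_le hq (hxz v) (hw ▸ hxz w)

end IdC

section Counting

variable {ι γ : Type*} [Fintype ι] [DecidableEq ι]

theorem card_filter_sum_le_exp_mul_prod (w : ι → γ → ℝ) (G : ι → Finset γ) {a : ℝ} (ha : 0 ≤ a)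
    (M : ℝ) : (((Fintype.piFinset G).filter fun f => ∑ i, w i (f i) ≤ M).card : ℝ)
      ≤ Real.exp (a * M) * ∏ i, ∑ g ∈ G i, Real.exp (-(a * w i g)) := by
  calc (((Fintype.piFinset G).filter fun f => ∑ i, w i (f i) ≤ M).card : ℝ)
      ≤ ∑ f ∈ (Fintype.piFinset G).filter fun f => ∑ i, w i (f i) ≤ M,
          Real.exp (a * (M - ∑ i, w i (f i))) := by
        rw [Finset.card_eq_sum_ones, Nat.cast_sum, Nat.cast_one]
        gcongr with f hf
        exact Real.one_le_exp (mul_nonneg ha (sub_nonneg.2 (Finset.mem_filter.1 hf).2))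
    _ ≤ ∑ f ∈ Fintype.piFinset G, Real.exp (a * (M - ∑ i, w i (f i))) :=
        Finset.sum_le_sum_of_subset_of_nonneg (Finset.filter_subset _ _) fun _ _ _ => by positivity
    _ = Real.exp (a * M) * ∏ i, ∑ g ∈ G i, Real.exp (-(a * w i g)) := by
        rw [Finset.prod_univ_sum, Finset.mul_sum]
        refine Finset.sum_congr rfl fun f _ => ?_
        rw [← Real.exp_sum, Finset.sum_neg_distrib, ← Finset.mul_sum, ← Real.exp_add, mul_sub,
          sub_eq_add_neg]

end Counting

section Lattice

variable {t δ : ℝ}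

theorem summable_exp_neg_norm_rpow (ht : 0 < t) :
    Summable fun g : Fin 2 → ℤ => Real.exp (-‖g‖ ^ t) := by
  have tendsto_norm : Filter.Tendsto (fun g : Fin 2 → ℤ => ‖g‖ ^ t) Filter.cofinite Filter.atTop :=
    (tendsto_rpow_atTop ht).comp
      (Filter.cocompact_eq_cofinite (Fin 2 → ℤ) ▸ tendsto_norm_cocompact_atTop)
  have decay := ((isLittleO_exp_neg_mul_rpow_atTop one_pos (-3 / t)).comp_tendsto
    tendsto_norm).isBigO
  refine summable_of_isBigO (EisensteinSeries.summable_one_div_norm_rpow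
    (show (2 : ℝ) < 3 by norm_num)) (decay.congr (fun g => by simp) fun g => ?_)
  rw [Function.comp_apply, ← Real.rpow_mul (norm_nonneg g), mul_div_cancel₀ _ ht.ne']

/-- The theta-like series `∑ exp (-‖g‖ ^ t)` over the lattice `ℤ²` with the maximum norm. It is the
constant in the exponential moment bounds that count lattice points in `ℓ_t` balls. -/
noncomputable def latticeSum (t : ℝ) : ℝ := ∑' g : Fin 2 → ℤ, Real.exp (-‖g‖ ^ t)

theorem latticeSum_nonneg (t : ℝ) : 0 ≤ latticeSum t := tsum_nonneg fun _ => by positivity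

theorem sum_exp_neg_mul_norm_rpow_le (ht : 0 < t) {a : ℝ} (ha : 1 ≤ a) (G : Finset (Fin 2 → ℤ)) :
    ∑ g ∈ G, Real.exp (-(a * ‖g‖ ^ t)) ≤ 1 + latticeSum t * Real.exp (1 - a) := by
  have one_le_norm {g : Fin 2 → ℤ} (hg : g ≠ 0) : 1 ≤ ‖g‖ := by
    obtain ⟨i, hi⟩ := Function.ne_iff.1 hg
    have : (1 : ℝ) ≤ |(g i : ℝ)| := by exact_mod_cast Int.one_le_abs hi
    exact this.trans (norm_le_pi_norm g i)
  have termwise (g : Fin 2 → ℤ) : Real.exp (-(a * ‖g‖ ^ t))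
      ≤ (if g = 0 then 1 else 0) + Real.exp (-‖g‖ ^ t) * Real.exp (1 - a) := by
    split_ifs with hg
    · rw [hg, norm_zero, Real.zero_rpow ht.ne', mul_zero, neg_zero, Real.exp_zero]
      exact le_add_of_nonneg_right (by positivity)
    · rw [zero_add, ← Real.exp_add]
      gcongr
      nlinarith [Real.one_le_rpow (one_le_norm hg) ht.le]
  calc ∑ g ∈ G, Real.exp (-(a * ‖g‖ ^ t))
      ≤ ∑ g ∈ G, ((if g = 0 then 1 else 0) + Real.exp (-‖g‖ ^ t) * Real.exp (1 - a)) :=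
        Finset.sum_le_sum fun g _ => termwise g
    _ = (if 0 ∈ G then 1 else 0) + (∑ g ∈ G, Real.exp (-‖g‖ ^ t)) * Real.exp (1 - a) := by
        rw [Finset.sum_add_distrib, Finset.sum_mul, Finset.sum_ite_eq']
    _ ≤ 1 + latticeSum t * Real.exp (1 - a) := by
        gcongr
        · split_ifs <;> norm_num
        · exact (summable_exp_neg_norm_rpow ht).sum_le_tsum G fun _ _ => (Real.exp_pos _).le

/-- The exponential moment bound with parameter `a = 1 + log (1 + card ι / m)`, which balances the
two factors `exp (a M)` and `(1 + latticeSum t * exp (1 - a)) ^ card ι`. -/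
theorem card_lattice_filter_le {ι : Type*} [Fintype ι] [DecidableEq ι] (ht : 0 < t) {m M : ℝ}
    (hm : 0 < m) (G : Finset (Fin 2 → ℤ)) :
    (((Fintype.piFinset fun _ : ι => G).filter fun f => ∑ i, ‖f i‖ ^ t ≤ M).card : ℝ)
      ≤ Real.exp (M * (1 + Real.log (1 + Fintype.card ι / m)) + latticeSum t * m) := by
  set N := Fintype.card ι
  set a := 1 + Real.log (1 + N / m) with ha
  have ha₁ : 1 ≤ a :=
    le_add_of_nonneg_right (Real.log_nonneg (le_add_of_nonneg_right (by positivity)))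
  have hexp : Real.exp (1 - a) = (1 + N / m)⁻¹ := by
    rw [ha, sub_add_cancel_left, Real.exp_neg, Real.exp_log (by positivity)]
  have hNm : N * (1 + N / m)⁻¹ ≤ m := by
    rw [← div_eq_mul_inv, div_le_iff₀ (by positivity), mul_add, mul_div_cancel₀ _ hm.ne']
    linarith
  calc _ ≤ Real.exp (a * M) * ∏ _i : ι, ∑ g ∈ G, Real.exp (-(a * ‖g‖ ^ t)) :=
        card_filter_sum_le_exp_mul_prod _ _ (by linarith) M
    _ ≤ Real.exp (a * M) * (1 + latticeSum t * Real.exp (1 - a)) ^ N := by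
        rw [Finset.prod_const, Finset.card_univ]
        gcongr
        exact sum_exp_neg_mul_norm_rpow_le ht ha₁ G
    _ ≤ Real.exp (a * M) * Real.exp (latticeSum t * Real.exp (1 - a)) ^ N := by
        have := latticeSum_nonneg t
        gcongr
        rw [add_comm]
        exact Real.add_one_le_exp _
    _ = Real.exp (M * a + latticeSum t * (N * (1 + N / m)⁻¹)) := by
        rw [← Real.exp_nat_mul, ← Real.exp_add, hexp]
        ring_nf
    _ ≤ Real.exp (M * a + latticeSum t * m) := by
        have := latticeSum_nonneg t
        gcongr

/-- The point of the square lattice `δ ℤ[i]` with integer coordinates `g`. -/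
noncomputable def gridPoint (δ : ℝ) (g : Fin 2 → ℤ) : ℂ := ⟨δ * g 0, δ * g 1⟩

/-- The integer coordinates of the point of the square lattice `δ ℤ[i]` obtained from `z` by
rounding its real and imaginary parts. -/
noncomputable def gridRound (δ : ℝ) (z : ℂ) : Fin 2 → ℤ := ![round (z.re / δ), round (z.im / δ)]

theorem abs_sub_mul_round_div (hδ : 0 < δ) (s : ℝ) :
    |s - δ * round (s / δ)| = δ * |s / δ - round (s / δ)| := by
  rw [← abs_of_pos hδ, ← abs_mul, abs_of_pos hδ, mul_sub, mul_div_cancel₀ _ hδ.ne']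

theorem abs_sub_round_le_abs (s : ℝ) : |s - round s| ≤ |s| := by
  simpa using round_le s 0

theorem norm_sub_gridPoint_gridRound_le (hδ : 0 < δ) (z : ℂ) :
    ‖z - gridPoint δ (gridRound δ z)‖ ≤ δ := by
  have rounding_error (s : ℝ) : |s - δ * round (s / δ)| ≤ δ * (1 / 2) := by
    rw [abs_sub_mul_round_div hδ]
    exact mul_le_mul_of_nonneg_left (abs_sub_round _) hδ.le
  calc ‖z - gridPoint δ (gridRound δ z)‖
      ≤ |z.re - δ * round (z.re / δ)| + |z.im - δ * round (z.im / δ)| :=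
        Complex.norm_le_abs_re_add_abs_im _
    _ ≤ δ * (1 / 2) + δ * (1 / 2) := add_le_add (rounding_error _) (rounding_error _)
    _ = δ := by ring

theorem norm_sub_gridPoint_gridRound_le_norm (hδ : 0 < δ) (z : ℂ) :
    ‖z - gridPoint δ (gridRound δ z)‖ ≤ ‖z‖ := by
  have rounding_contracts (s : ℝ) : |s - δ * round (s / δ)| ≤ |s| := by
    calc |s - δ * round (s / δ)| = δ * |s / δ - round (s / δ)| := abs_sub_mul_round_div hδ s
      _ ≤ δ * |s / δ| := mul_le_mul_of_nonneg_left (abs_sub_round_le_abs _) hδ.le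
      _ = |s| := by rw [abs_div, abs_of_pos hδ, mul_div_cancel₀ _ hδ.ne']
  rw [Complex.norm_def, Complex.norm_def, Complex.normSq_apply, Complex.normSq_apply]
  exact Real.sqrt_le_sqrt (add_le_add (abs_le_iff_mul_self_le.1 (rounding_contracts z.re))
    (abs_le_iff_mul_self_le.1 (rounding_contracts z.im)))

theorem norm_gridRound_le (hδ : 0 < δ) (z : ℂ) : ‖gridRound δ z‖ ≤ 2 * ‖z‖ / δ := by
  have abs_round_le (s : ℝ) : |(round (s / δ) : ℝ)| ≤ 2 * |s| / δ := by
    calc |(round (s / δ) : ℝ)| ≤ |s / δ| + |s / δ - round (s / δ)| := by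
          simpa using abs_sub (s / δ) (s / δ - round (s / δ))
      _ ≤ |s / δ| + |s / δ| := add_le_add_right (abs_sub_round_le_abs _) _
      _ = 2 * |s| / δ := by rw [abs_div, abs_of_pos hδ]; ring
  have bound {s : ℝ} (hs : |s| ≤ ‖z‖) : ‖round (s / δ)‖ ≤ 2 * ‖z‖ / δ :=
    (abs_round_le s).trans (by gcongr)
  refine (pi_norm_le_iff_of_nonneg (by positivity)).2 (Fin.forall_fin_two.2 ⟨?_, ?_⟩)
  · exact bound (Complex.abs_re_le_norm z)
  · exact bound (Complex.abs_im_le_norm z)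

end Lattice

section Covers

variable {p : ℝ≥0∞} {ι : Type*} [Fintype ι]

theorem sum_norm_gridRound_rpow_le {δ : ℝ} (hp : 0 < p) (hp' : p ≠ ∞) (hδ : 0 < δ) {x : ι → ℂ}
    (hx : ‖toLp p x‖ ≤ 1) : ∑ i, ‖gridRound δ (x i)‖ ^ p.toReal ≤ (2 / δ) ^ p.toReal := by
  calc ∑ i, ‖gridRound δ (x i)‖ ^ p.toReal ≤ ∑ i, (2 * ‖x i‖ / δ) ^ p.toReal := by
        gcongr with i
        exact norm_gridRound_le hδ (x i)
    _ = (2 / δ) ^ p.toReal * ∑ i, ‖x i‖ ^ p.toReal := by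
        rw [Finset.mul_sum]
        refine Finset.sum_congr rfl fun i _ => ?_
        rw [← Real.mul_rpow (by positivity) (by positivity), mul_div_right_comm]
    _ ≤ (2 / δ) ^ p.toReal := by
        rw [norm_toLp_le_iff hp hp' zero_le_one, Real.one_rpow] at hx
        exact mul_le_of_le_one_right (by positivity) hx

theorem exists_lattice_cover (hp : 0 < p) (hp' : p ≠ ∞) {m : ℝ} (hm : 0 < m) :
    ∃ Z : Finset (ι → ℂ), (Z.card : ℝ) ≤ Real.exp ((2 ^ p.toReal + latticeSum p.toReal) * m *
        (1 + Real.log (1 + Fintype.card ι / m))) ∧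
      ∀ x, ‖toLp p x‖ ≤ 1 → ∃ z ∈ Z,
        ‖x - z‖ ≤ m ^ (-(1 / p).toReal) ∧ ∀ i, ‖x i - z i‖ ≤ ‖x i‖ := by
  classical
  set t := p.toReal
  set δ := m ^ (-(1 / p).toReal) with hδ
  have hδ₀ : 0 < δ := by positivity
  have hM : (2 / δ) ^ t = 2 ^ t * m := by
    rw [hδ, Real.rpow_neg hm.le, div_inv_eq_mul, Real.mul_rpow (by positivity) (by positivity),
      rpow_toReal_one_div_rpow hp hp' hm.le]
  set G : Finset (Fin 2 → ℤ) :=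
    ((isCompact_closedBall (0 : Fin 2 → ℤ) (2 / δ)).finite_of_discrete).toFinset with hG
  set F := (Fintype.piFinset fun _ : ι => G).filter fun f => ∑ i, ‖f i‖ ^ t ≤ 2 ^ t * m
  refine ⟨F.image fun f i => gridPoint δ (f i), ?_, fun x hx =>
    ⟨fun i => gridPoint δ (gridRound δ (x i)), Finset.mem_image_of_mem _ (a := fun i => _)
      (Finset.mem_filter.2 ⟨Fintype.mem_piFinset.2 fun i => ?_, ?_⟩), ?_,
      fun i => norm_sub_gridPoint_gridRound_le_norm hδ₀ (x i)⟩⟩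
  · have hS := latticeSum_nonneg t
    have hlog : 0 ≤ Real.log (1 + Fintype.card ι / m) :=
      Real.log_nonneg (le_add_of_nonneg_right (by positivity))
    calc ((F.image fun f i => gridPoint δ (f i)).card : ℝ) ≤ F.card := by
          exact_mod_cast Finset.card_image_le
      _ ≤ Real.exp (2 ^ t * m * (1 + Real.log (1 + Fintype.card ι / m)) + latticeSum t * m) :=
          card_lattice_filter_le (ENNReal.toReal_pos hp.ne' hp') hm G
      _ ≤ _ := by
          gcongr
          nlinarith [mul_nonneg (mul_nonneg hS hm.le) hlog]
  · rw [hG, Set.Finite.mem_toFinset, mem_closedBall_zero_iff]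
    refine (norm_gridRound_le hδ₀ (x i)).trans ?_
    have hxi : ‖x i‖ ≤ 1 := (norm_le_pi_norm x i).trans ((norm_le_norm_toLp hp x).trans hx)
    gcongr
    linarith
  · rw [← hM]
    exact sum_norm_gridRound_rpow_le hp hp' hδ₀ hx
  · exact (pi_norm_le_iff_of_nonneg hδ₀.le).2 fun i => norm_sub_gridPoint_gridRound_le hδ₀ (x i)

theorem exists_sup_cover (hp : 0 < p) : ∃ A : ℝ, 1 ≤ A ∧ ∀ n : ℕ, 1 ≤ n →
    ∃ Z : Finset (Fin n → ℂ), (Z.card : ℝ) ≤ A ^ n ∧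
      ∀ x, ‖toLp p x‖ ≤ 1 → ∃ z ∈ Z, ‖x - z‖ ≤ (n : ℝ) ^ (-(1 / p).toReal) := by
  rcases eq_or_ne p ∞ with rfl | hp'
  · exact ⟨1, le_rfl, fun n _ => ⟨{0}, by simp, fun x hx => ⟨0, by simp, by simpa using hx⟩⟩⟩
  · set C := 2 ^ p.toReal + latticeSum p.toReal
    have hC : 0 ≤ C := add_nonneg (by positivity) (latticeSum_nonneg _)
    refine ⟨Real.exp (C * (1 + Real.log 2)), Real.one_le_exp (by positivity), fun n hn => ?_⟩
    have hn₀ : (0 : ℝ) < n := by exact_mod_cast hn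
    obtain ⟨Z, hZ, hcover⟩ := exists_lattice_cover (ι := Fin n) hp hp' hn₀
    refine ⟨Z, hZ.trans_eq ?_, fun x hx => ?_⟩
    · rw [Fintype.card_fin, div_self hn₀.ne', one_add_one_eq_two, ← Real.exp_nat_mul]
      congr 1
      ring
    · obtain ⟨z, hz, hxz, -⟩ := hcover x hx
      exact ⟨z, hz, hxz⟩

theorem exists_refined_cover {d : ℝ} (hd : 0 < d) (Z : Finset (ι → ℂ)) {s : ℕ} (hs : 1 ≤ s) :
    ∃ Y : Finset (ι → ℂ), Y.card ≤ Z.card * (5 * s) ^ (2 * Fintype.card ι) ∧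
      ∀ x, ∀ z ∈ Z, ‖x - z‖ ≤ d → ∃ y ∈ Y, ‖x - y‖ ≤ d / s := by
  classical
  set δ := d / s
  have hδ : 0 < δ := by positivity
  set B : Finset (Fin 2 → ℤ) := Fintype.piFinset fun _ => Finset.Icc (-(2 * s : ℤ)) (2 * s)
    with hB
  have hB_card : B.card ≤ (5 * s) ^ 2 := by
    rw [hB, Fintype.card_piFinset_const, Int.card_Icc]
    gcongr
    omega
  have mem_B {g : Fin 2 → ℤ} (hg : ‖g‖ ≤ 2 * s) : g ∈ B := by
    refine Fintype.mem_piFinset.2 fun j => ?_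
    rw [Finset.mem_Icc, ← abs_le]
    have : |(g j : ℝ)| ≤ 2 * s := (norm_le_pi_norm g j).trans hg
    exact_mod_cast this
  refine ⟨(Z ×ˢ Fintype.piFinset fun _ : ι => B).image fun u i => u.1 i + gridPoint δ (u.2 i),
    ?_, fun x z hz hxz => ⟨fun i => z i + gridPoint δ (gridRound δ (x i - z i)),
      Finset.mem_image_of_mem _ (a := (z, fun i => _))
        (Finset.mem_product.2 ⟨hz, Fintype.mem_piFinset.2 fun i => mem_B ?_⟩), ?_⟩⟩
  · refine Finset.card_image_le.trans ?_
    rw [Finset.card_product, Fintype.card_piFinset, Finset.prod_const, Finset.card_univ, pow_mul]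
    gcongr
  · calc ‖gridRound δ (x i - z i)‖ ≤ 2 * ‖x i - z i‖ / δ := norm_gridRound_le hδ _
      _ ≤ 2 * d / δ := by
          gcongr
          exact (norm_le_pi_norm (x - z) i).trans hxz
      _ = 2 * s := by rw [mul_div_assoc, div_div_cancel₀ hd.ne']
  · refine (pi_norm_le_iff_of_nonneg hδ.le).2 fun i => ?_
    rw [Pi.sub_apply, ← sub_sub]
    exact norm_sub_gridPoint_gridRound_le hδ _

end Covers

/-- The rate of `entropyNumber k (idC p q n)` for `p ≤ q` and `log₂ (2 n) ≤ k ≤ 2 n`. -/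
noncomputable def logRate (p q : ℝ≥0∞) (n k : ℕ) : ℝ :=
  (Real.logb 2 (1 + 2 * n / k) / k) ^ ((1 / p).toReal - (1 / q).toReal)

/-- The rate that comparing volumes gives: up to constants `volumeRate p q n k ^ (2 * n)` is
`2 ^ (1 - k)` times the ratio of the volumes of the unit balls of `EllC p n` and `EllC q n`, which
have real dimension `2 * n`. -/
noncomputable def volumeRate (p q : ℝ≥0∞) (n k : ℕ) : ℝ :=
  (2 : ℝ) ^ (-((k - 1 : ℝ) / (2 * n))) * (n : ℝ) ^ ((1 / q).toReal - (1 / p).toReal)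

theorem logRate_nonneg (p q : ℝ≥0∞) (n k : ℕ) : 0 ≤ logRate p q n k := by
  refine Real.rpow_nonneg (div_nonneg (Real.logb_nonneg one_lt_two ?_) k.cast_nonneg) _
  exact le_add_of_nonneg_right (by positivity)

theorem volumeRate_pos (p q : ℝ≥0∞) {n k : ℕ} (hn : 1 ≤ n) : 0 < volumeRate p q n k := by
  unfold volumeRate
  positivity

section Logarithms

variable {a C k n x : ℝ}

theorem one_le_logb_two_one_add (hx : 1 ≤ x) : 1 ≤ Real.logb 2 (1 + x) := by
  rw [Real.le_logb_iff_rpow_le one_lt_two (by linarith), Real.rpow_one]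
  linarith

theorem log_one_add_le_logb_two (hx : 0 ≤ x) : Real.log (1 + x) ≤ Real.logb 2 (1 + x) :=
  le_div_self (Real.log_nonneg (by linarith)) (Real.log_pos one_lt_two)
    (Real.log_two_lt_d9.le.trans (by norm_num))

theorem logb_two_one_add_le (hx : 0 ≤ x) : Real.logb 2 (1 + x) ≤ 2 * x := by
  have hlog : Real.log (1 + x) ≤ x := by
    linarith [Real.log_le_sub_one_of_pos (show 0 < 1 + x by linarith)]
  rw [Real.logb, div_le_iff₀ (Real.log_pos one_lt_two)]
  nlinarith [Real.log_two_gt_d9]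

theorem log_one_add_mul_logb_two_le (ha : 1 ≤ a) (hx : 0 ≤ x) :
    Real.log (1 + x / 2 * (a * Real.logb 2 (1 + x))) ≤
      Real.log a + 2 * Real.logb 2 (1 + x) := by
  have hL : 0 ≤ Real.logb 2 (1 + x) := Real.logb_nonneg one_lt_two (by linarith)
  calc Real.log (1 + x / 2 * (a * Real.logb 2 (1 + x)))
      ≤ Real.log (a * (1 + x) ^ 2) := by
        refine Real.log_le_log (by positivity) ?_
        calc 1 + x / 2 * (a * Real.logb 2 (1 + x)) ≤ 1 + x / 2 * (a * (2 * x)) := by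
              gcongr
              exact logb_two_one_add_le hx
          _ ≤ a * (1 + x) ^ 2 := by nlinarith [mul_nonneg (zero_le_one.trans ha) hx]
    _ = Real.log a + 2 * Real.log (1 + x) := by
        rw [Real.log_mul (by positivity) (by positivity), Real.log_pow]
        norm_num
    _ ≤ Real.log a + 2 * Real.logb 2 (1 + x) := by
        gcongr
        exact log_one_add_le_logb_two hx

theorem mul_three_add_log_sq_le (hC : 1 ≤ C) :
    C * (3 + Real.log ((16 * C) ^ 2)) ≤ (16 * C) ^ 2 / 4 := by
  have hlog : Real.log ((16 * C) ^ 2) ≤ 2 * (16 * C) := by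
    rw [Real.log_pow, Nat.cast_two]
    gcongr
    exact Real.log_le_self (by positivity)
  calc C * (3 + Real.log ((16 * C) ^ 2)) ≤ C * (3 + 2 * (16 * C)) := by gcongr
    _ ≤ (16 * C) ^ 2 / 4 := by nlinarith

theorem lattice_exponent_le (hC : 1 ≤ C) (hk : 2 ≤ k) (hkn : k ≤ 2 * n) {m : ℝ}
    (hm : m = k / ((16 * C) ^ 2 * Real.logb 2 (1 + 2 * n / k))) :
    C * m * (1 + Real.log (1 + n / m)) ≤ (k - 1) * Real.log 2 := by
  set a := (16 * C) ^ 2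
  set L := Real.logb 2 (1 + 2 * n / k)
  have ha₁ : 1 ≤ a := one_le_pow₀ (by linarith)
  have hx : 1 ≤ 2 * n / k := (one_le_div (by linarith)).2 hkn
  have hL : 1 ≤ L := one_le_logb_two_one_add hx
  have hm₀ : 0 < m := by rw [hm]; positivity
  have hlog : Real.log (1 + n / m) ≤ Real.log a + 2 * L := by
    have hnm : n / m = 2 * n / k / 2 * (a * L) := by rw [hm]; field_simp
    rw [hnm]
    exact log_one_add_mul_logb_two_le ha₁ (by positivity)
  have hsum : 1 + Real.log (1 + n / m) ≤ (3 + Real.log a) * L := by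
    nlinarith [Real.log_nonneg ha₁]
  calc C * m * (1 + Real.log (1 + n / m)) ≤ C * m * ((3 + Real.log a) * L) := by gcongr
    _ = C * (3 + Real.log a) * (k / a) := by rw [hm]; field_simp
    _ ≤ a / 4 * (k / a) := by
        gcongr
        exact mul_three_add_log_sq_le hC
    _ = k / 4 := by field_simp
    _ ≤ (k - 1) * Real.log 2 := by nlinarith [Real.log_two_gt_d9]

end Logarithms

theorem le_two_pow_pred_of_le_exp {N k : ℕ} {t : ℝ} (hk : 1 ≤ k) (hN : (N : ℝ) ≤ Real.exp t)
    (ht : t ≤ (k - 1) * Real.log 2) : N ≤ 2 ^ (k - 1) := by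
  have hexp : Real.exp ((k - 1) * Real.log 2) = 2 ^ (k - 1) := by
    rw [← Nat.cast_pred hk, Real.exp_nat_mul, Real.exp_log two_pos]
  have hcast : (N : ℝ) ≤ 2 ^ (k - 1) := hN.trans ((Real.exp_le_exp.2 ht).trans_eq hexp)
  exact_mod_cast hcast

section UpperBounds

variable {p q : ℝ≥0∞}

theorem entropyNumber_idC_le_one (hp : 0 < p) (hpq : p ≤ q) (n k : ℕ) :
    entropyNumber k (idC p q n) ≤ 1 :=
  entropyNumber_idC_le_of_norm_le (hp.trans_le hpq) one_pos fun _ =>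
    norm_toLp_le_one_of_le hp hpq

theorem entropyNumber_idC_le_of_exponent_le {n k : ℕ} {m : ℝ} (hp : 0 < p) (hp' : p ≠ ∞)
    (hpq : p ≤ q) (hk : 1 ≤ k) (hm : 0 < m)
    (h : (2 ^ p.toReal + latticeSum p.toReal) * m * (1 + Real.log (1 + n / m)) ≤
      (k - 1) * Real.log 2) :
    entropyNumber k (idC p q n) ≤ m ^ ((1 / q).toReal - (1 / p).toReal) := by
  obtain ⟨Z, hZ, hcover⟩ := exists_lattice_cover (ι := Fin n) hp hp' hm
  rw [Fintype.card_fin] at hZ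
  refine entropyNumber_idC_le_of_cover (hp.trans_le hpq) (by positivity)
    (le_two_pow_pred_of_le_exp hk hZ h) fun x hx => ?_
  obtain ⟨z, hz, hxz, hxz'⟩ := hcover x hx
  exact ⟨z, hz, norm_toLp_le_of_norm_apply_le hp hpq hm ((norm_toLp_mono hp hxz').trans hx) hxz⟩

theorem exists_entropyNumber_idC_le_logRate (hp : 0 < p) (hpq : p ≤ q) :
    ∃ C : ℝ, 1 ≤ C ∧ ∀ n k : ℕ, 1 ≤ k → k ≤ 2 * n →
      entropyNumber k (idC p q n) ≤ C * logRate p q n k := by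
  rcases eq_or_ne p ∞ with rfl | hp'
  · obtain rfl : q = ∞ := top_le_iff.1 hpq
    refine ⟨1, le_rfl, fun n k _ _ => ?_⟩
    rw [logRate, sub_self, Real.rpow_zero, mul_one]
    exact entropyNumber_idC_le_one hp le_rfl n k
  set γ := (1 / p).toReal - (1 / q).toReal with hγ
  have hγ₀ : 0 ≤ γ := sub_nonneg.2 (toReal_one_div_anti hp hpq)
  set K := 2 ^ p.toReal + latticeSum p.toReal
  have hK : 1 ≤ K := le_add_of_le_of_nonneg
    (Real.one_le_rpow one_le_two ENNReal.toReal_nonneg) (latticeSum_nonneg _)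
  set a := (16 * K) ^ 2
  have hC : 1 ≤ a ^ γ := Real.one_le_rpow (one_le_pow₀ (by linarith)) hγ₀
  refine ⟨a ^ γ, hC, fun n k hk hkn => ?_⟩
  have hkn' : (k : ℝ) ≤ 2 * n := by exact_mod_cast hkn
  set L := Real.logb 2 (1 + 2 * n / k) with hL
  have hL₁ : 1 ≤ L := one_le_logb_two_one_add ((one_le_div (by positivity)).2 hkn')
  rcases hk.eq_or_lt with rfl | hk₂
  · refine (entropyNumber_idC_le_one hp hpq n 1).trans ?_
    exact one_le_mul_of_one_le_of_one_le hC (Real.one_le_rpow (by simpa [hL] using hL₁) hγ₀)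
  set m := k / (a * L) with hm
  have hm₀ : 0 < m := by positivity
  have hrate : a ^ γ * logRate p q n k = m ^ ((1 / q).toReal - (1 / p).toReal) := by
    rw [logRate, ← hL, ← hγ, ← Real.mul_rpow (by positivity) (by positivity), ← neg_sub,
      ← hγ, Real.rpow_neg hm₀.le, ← Real.inv_rpow hm₀.le, hm, inv_div, mul_div_assoc]
  rw [hrate]
  exact entropyNumber_idC_le_of_exponent_le hp hp' hpq hk hm₀
    (lattice_exponent_le hK (by exact_mod_cast hk₂) hkn' hm)

theorem two_rpow_neg_pow_mul_two_pow_pred {n k : ℕ} (hn : 1 ≤ n) (hk : 1 ≤ k) :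
    ((2 : ℝ) ^ (-((k - 1 : ℝ) / (2 * n)))) ^ (2 * n) * 2 ^ (k - 1) = 1 := by
  have hn₀ : (n : ℝ) ≠ 0 := by positivity
  have hexp : -((k - 1 : ℝ) / (2 * n)) * (2 * n : ℕ) = -((k - 1 : ℕ) : ℝ) := by
    rw [Nat.cast_pred hk]
    push_cast
    field_simp
  rw [← Real.rpow_mul_natCast two_pos.le, hexp, Real.rpow_neg two_pos.le, Real.rpow_natCast,
    inv_mul_cancel₀ (by positivity)]

theorem exists_natCast_approx {t : ℝ} (ht : 1 ≤ t) : ∃ s : ℕ, 1 ≤ s ∧ s ≤ t ∧ t ≤ 2 * s := by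
  have hs : 1 ≤ ⌊t⌋₊ := Nat.le_floor (by simpa using ht)
  refine ⟨⌊t⌋₊, hs, Nat.floor_le (by linarith), ?_⟩
  have hs' : (1 : ℝ) ≤ ⌊t⌋₊ := by exact_mod_cast hs
  linarith [Nat.lt_floor_add_one t]

theorem exists_sup_cover_card_le_two_pow (hp : 0 < p) :
    ∃ A : ℝ, 1 ≤ A ∧ ∀ n k : ℕ, 1 ≤ n → 1 ≤ k → A * 2 ^ (-((k - 1 : ℝ) / (2 * n))) ≤ 1 →
      ∃ Y : Finset (Fin n → ℂ), Y.card ≤ 2 ^ (k - 1) ∧ ∀ x, ‖toLp p x‖ ≤ 1 → ∃ y ∈ Y,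
        ‖x - y‖ ≤ 2 * A * 2 ^ (-((k - 1 : ℝ) / (2 * n))) * (n : ℝ) ^ (-(1 / p).toReal) := by
  obtain ⟨A, hA, hsup⟩ := exists_sup_cover hp
  refine ⟨5 * A, by linarith, fun n k hn hk hτ => ?_⟩
  set τ := (2 : ℝ) ^ (-((k - 1 : ℝ) / (2 * n)))
  have hτ₀ : 0 < 5 * A * τ := by positivity
  obtain ⟨s, hs, hsτ, hτs⟩ := exists_natCast_approx ((one_le_inv₀ hτ₀).2 hτ)
  rw [inv_eq_one_div] at hsτ hτs
  rw [le_div_iff₀ hτ₀] at hsτ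
  rw [div_le_iff₀ hτ₀] at hτs
  obtain ⟨Z, hZ, hcover⟩ := hsup n hn
  set d := (n : ℝ) ^ (-(1 / p).toReal)
  have hd : 0 < d := by positivity
  obtain ⟨Y, hY, hrefined⟩ := exists_refined_cover hd Z hs
  refine ⟨Y, ?_, fun x hx => ?_⟩
  · have hcard : (Y.card : ℝ) ≤ 2 ^ (k - 1) := by
      calc (Y.card : ℝ) ≤ Z.card * (5 * s) ^ (2 * n) := by
            rw [Fintype.card_fin] at hY
            exact_mod_cast hY
        _ ≤ A ^ (2 * n) * (5 * s) ^ (2 * n) := by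
            gcongr
            exact hZ.trans (pow_le_pow_right₀ hA (by omega))
        _ = (s * (5 * A * τ)) ^ (2 * n) * 2 ^ (k - 1) := by
            linear_combination (-(A ^ (2 * n) * (5 * s) ^ (2 * n)) : ℝ) *
              two_rpow_neg_pow_mul_two_pow_pred hn hk
        _ ≤ 2 ^ (k - 1) :=
            mul_le_of_le_one_left (by positivity) (pow_le_one₀ (by positivity) hsτ)
    exact_mod_cast hcard
  · obtain ⟨z, hz, hxz⟩ := hcover x hx
    obtain ⟨y, hy, hxy⟩ := hrefined x z hz hxz
    refine ⟨y, hy, hxy.trans ?_⟩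
    rw [div_le_iff₀ (by positivity), mul_right_comm]
    exact le_mul_of_one_le_left hd.le (hτs.trans_eq (by ring))

theorem exists_entropyNumber_idC_le_volumeRate_of_large (hp : 0 < p) (hq : 0 < q) :
    ∃ A : ℝ, 1 ≤ A ∧ ∀ n k : ℕ, 1 ≤ n → 1 ≤ k → A * 2 ^ (-((k - 1 : ℝ) / (2 * n))) ≤ 1 →
      entropyNumber k (idC p q n) ≤ 2 * A * volumeRate p q n k := by
  obtain ⟨A, hA, hsup⟩ := exists_sup_cover_card_le_two_pow hp
  refine ⟨A, hA, fun n k hn hk hτ => ?_⟩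
  have hn₀ : (0 : ℝ) < n := by exact_mod_cast hn
  obtain ⟨Y, hY, hcover⟩ := hsup n k hn hk hτ
  refine entropyNumber_idC_le_of_cover hq (mul_pos (by positivity) (volumeRate_pos p q hn)) hY
    fun x hx => ?_
  obtain ⟨y, hy, hxy⟩ := hcover x hx
  refine ⟨y, hy, ?_⟩
  calc ‖toLp q (x - y)‖ ≤ (n : ℝ) ^ (1 / q).toReal * ‖x - y‖ := by
        simpa only [Fintype.card_fin] using norm_toLp_le_card_rpow_mul hq (x - y)
    _ ≤ (n : ℝ) ^ (1 / q).toReal *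
          (2 * A * 2 ^ (-((k - 1 : ℝ) / (2 * n))) * (n : ℝ) ^ (-(1 / p).toReal)) := by gcongr
    _ = 2 * A * volumeRate p q n k := by
        rw [volumeRate, sub_eq_add_neg (1 / q).toReal, Real.rpow_add hn₀]
        ring

theorem exists_entropyNumber_idC_le_volumeRate_of_le (hp : 0 < p) (hq : 0 < q) {C : ℝ}
    (hC : 1 ≤ C) : ∃ C' : ℝ, 0 < C' ∧ ∀ n k : ℕ, 1 ≤ n → 1 ≤ k →
      entropyNumber k (idC p q n) ≤ C * (n : ℝ) ^ ((1 / q).toReal - (1 / p).toReal) →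
      entropyNumber k (idC p q n) ≤ C' * volumeRate p q n k := by
  obtain ⟨A, hA, hlarge⟩ := exists_entropyNumber_idC_le_volumeRate_of_large hp hq
  refine ⟨2 * A * C, by positivity, fun n k hn hk h => ?_⟩
  have hrate := (volumeRate_pos p q hn (k := k)).le
  rcases le_total (A * 2 ^ (-((k - 1 : ℝ) / (2 * n)))) 1 with hτ | hτ
  · exact (hlarge n k hn hk hτ).trans
      (mul_le_mul_of_nonneg_right (le_mul_of_one_le_right (by positivity) hC) hrate)
  · calc entropyNumber k (idC p q n)
        ≤ C * (n : ℝ) ^ ((1 / q).toReal - (1 / p).toReal) := h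
      _ ≤ A * 2 ^ (-((k - 1 : ℝ) / (2 * n))) *
            (C * (n : ℝ) ^ ((1 / q).toReal - (1 / p).toReal)) :=
          le_mul_of_one_le_left (by positivity) hτ
      _ = A * C * volumeRate p q n k := by rw [volumeRate]; ring
      _ ≤ 2 * A * C * volumeRate p q n k := by
          gcongr
          linarith

theorem exists_entropyNumber_idC_le_volumeRate (hq : 0 < q) (hqp : q ≤ p) :
    ∃ C : ℝ, 0 < C ∧ ∀ n k : ℕ, 1 ≤ n → 1 ≤ k →
      entropyNumber k (idC p q n) ≤ C * volumeRate p q n k := by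
  obtain ⟨C, hC, hle⟩ := exists_entropyNumber_idC_le_volumeRate_of_le (hq.trans_le hqp) hq le_rfl
  refine ⟨C, hC, fun n k hn hk => hle n k hn hk ?_⟩
  rw [one_mul]
  refine entropyNumber_idC_le_of_norm_le hq (by positivity) fun x hx => ?_
  have h := norm_toLp_le_card_rpow_mul_norm_toLp hq hqp x
  rw [Fintype.card_fin] at h
  exact h.trans (mul_le_of_le_one_right (by positivity) hx)

theorem logRate_two_mul_le {n : ℕ} (hp : 0 < p) (hpq : p ≤ q) (hn : 1 ≤ n) :
    logRate p q n (2 * n) ≤ (n : ℝ) ^ ((1 / q).toReal - (1 / p).toReal) := by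
  have hn₀ : (0 : ℝ) < n := by exact_mod_cast hn
  have hlog : Real.logb 2 (1 + 2 * n / (2 * n : ℕ)) = 1 := by
    rw [Nat.cast_mul, Nat.cast_two, div_self (by positivity), one_add_one_eq_two,
      Real.logb_self_eq_one one_lt_two]
  rw [logRate, hlog, ← neg_sub (1 / p).toReal, Real.rpow_neg hn₀.le, ← Real.inv_rpow hn₀.le,
    ← one_div]
  refine Real.rpow_le_rpow (by positivity) ?_ (sub_nonneg.2 (toReal_one_div_anti hp hpq))
  gcongr
  omega

theorem exists_entropyNumber_idC_le_volumeRate_of_two_mul_le (hp : 0 < p) (hpq : p ≤ q) :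
    ∃ C : ℝ, 0 < C ∧ ∀ n k : ℕ, 1 ≤ n → 2 * n ≤ k →
      entropyNumber k (idC p q n) ≤ C * volumeRate p q n k := by
  have hq : 0 < q := hp.trans_le hpq
  obtain ⟨C, hC, hmid⟩ := exists_entropyNumber_idC_le_logRate hp hpq
  obtain ⟨C', hC', hle⟩ := exists_entropyNumber_idC_le_volumeRate_of_le hp hq hC
  refine ⟨C', hC', fun n k hn hnk => hle n k hn (by omega) ?_⟩
  calc entropyNumber k (idC p q n) ≤ entropyNumber (2 * n) (idC p q n) :=
        entropyNumber_idC_anti hp hq hnk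
    _ ≤ C * logRate p q n (2 * n) := hmid n (2 * n) (by omega) le_rfl
    _ ≤ C * (n : ℝ) ^ ((1 / q).toReal - (1 / p).toReal) := by
        gcongr
        exact logRate_two_mul_le hp hpq hn

end UpperBounds

section Volume

variable {p q : ℝ≥0∞}

theorem pow_finrank_le_card_mul_pow {E : Type*} [NormedAddCommGroup E] [NormedSpace ℝ E]
    [FiniteDimensional ℝ E] {d ρ : ℝ} (hd : 0 ≤ d) (hρ : 0 ≤ ρ) {Z : Finset E}
    (h : Metric.closedBall 0 d ⊆ ⋃ z ∈ Z, Metric.closedBall z ρ) :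
    d ^ Module.finrank ℝ E ≤ Z.card * ρ ^ Module.finrank ℝ E := by
  borelize E
  set μ : MeasureTheory.Measure E := MeasureTheory.Measure.addHaar
  have hμ := (MeasureTheory.measure_mono (μ := μ) h).trans
    (MeasureTheory.measure_biUnion_finset_le Z _)
  simp only [μ.addHaar_closedBall _ hd, μ.addHaar_closedBall _ hρ, Finset.sum_const,
    nsmul_eq_mul] at hμ
  rwa [← mul_assoc, ENNReal.mul_le_mul_iff_left (Metric.measure_ball_pos μ _ one_pos).ne'
      MeasureTheory.measure_ball_lt_top.ne, ← ENNReal.ofReal_natCast,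
    ← ENNReal.ofReal_mul (by positivity), ENNReal.ofReal_le_ofReal_iff (by positivity)] at hμ

theorem finrank_real_complex_pi {ι : Type*} [Fintype ι] :
    Module.finrank ℝ (ι → ℂ) = 2 * Fintype.card ι := by
  rw [Module.finrank_pi_fintype, Finset.sum_const, Complex.finrank_real_complex,
    Finset.card_univ, smul_eq_mul, mul_comm]

theorem exists_sup_cover_of_cover {ι : Type*} [Fintype ι] (hq : 0 < q) {r e : ℝ} (hr : 0 < r)
    {Y Z : Finset (ι → ℂ)}
    (hZ : ∀ x : ι → ℂ, ‖toLp q x‖ ≤ 1 → ∃ z ∈ Z, ‖x - z‖ ≤ e) :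
    ∃ W : Finset (ι → ℂ), W.card ≤ Y.card * Z.card ∧
      ∀ x, ∀ y ∈ Y, ‖toLp q (x - y)‖ ≤ r → ∃ w ∈ W, ‖x - w‖ ≤ r * e := by
  classical
  refine ⟨Finset.image₂ (fun y z => y + (r : ℂ) • z) Y Z, Finset.card_image₂_le _ _ _,
    fun x y hy hxy => ?_⟩
  have hr' : (r : ℂ) ≠ 0 := by exact_mod_cast hr.ne'
  have hnorm : ‖(r : ℂ)‖ = r := by rw [Complex.norm_real, Real.norm_of_nonneg hr.le]
  obtain ⟨z, hz, hxz⟩ := hZ ((r : ℂ)⁻¹ • (x - y)) (by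
    rw [norm_toLp_smul hq, norm_inv, hnorm]
    exact inv_mul_le_one_of_le₀ hxy hr.le)
  refine ⟨y + (r : ℂ) • z, Finset.mem_image₂_of_mem hy hz, ?_⟩
  have hsub : x - (y + (r : ℂ) • z) = (r : ℂ) • ((r : ℂ)⁻¹ • (x - y) - z) := by
    rw [smul_sub, smul_inv_smul₀ hr', sub_sub]
  rw [hsub, norm_smul, hnorm]
  gcongr

theorem card_rpow_neg_pow_le_of_cover {ι : Type*} [Fintype ι] [Nonempty ι] (hp : 0 < p)
    (hq : 0 < q) {r e : ℝ} (hr : 0 < r) (he : 0 ≤ e) {Y Z : Finset (ι → ℂ)}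
    (hY : ∀ x : ι → ℂ, ‖toLp p x‖ ≤ 1 → ∃ y ∈ Y, ‖toLp q (x - y)‖ ≤ r)
    (hZ : ∀ x : ι → ℂ, ‖toLp q x‖ ≤ 1 → ∃ z ∈ Z, ‖x - z‖ ≤ e) :
    ((Fintype.card ι : ℝ) ^ (-(1 / p).toReal)) ^ (2 * Fintype.card ι) ≤
      Y.card * Z.card * (r * e) ^ (2 * Fintype.card ι) := by
  set N := Fintype.card ι
  have hN : (0 : ℝ) < N := by exact_mod_cast Fintype.card_pos
  obtain ⟨W, hW, hcover⟩ := exists_sup_cover_of_cover hq hr (Y := Y) hZ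
  have hball : Metric.closedBall (0 : ι → ℂ) ((N : ℝ) ^ (-(1 / p).toReal)) ⊆
      ⋃ w ∈ W, Metric.closedBall w (r * e) := by
    intro x hx
    have hxp : ‖toLp p x‖ ≤ 1 := by
      calc ‖toLp p x‖ ≤ (N : ℝ) ^ (1 / p).toReal * ‖x‖ := norm_toLp_le_card_rpow_mul hp x
        _ ≤ (N : ℝ) ^ (1 / p).toReal * (N : ℝ) ^ (-(1 / p).toReal) := by
            gcongr
            exact mem_closedBall_zero_iff.1 hx
        _ = 1 := by rw [← Real.rpow_add hN, add_neg_cancel, Real.rpow_zero]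
    obtain ⟨y, hy, hxy⟩ := hY x hxp
    obtain ⟨w, hw, hxw⟩ := hcover x y hy hxy
    exact Set.mem_biUnion hw (mem_closedBall_iff_norm.2 hxw)
  have hvol := pow_finrank_le_card_mul_pow (by positivity) (by positivity) hball
  rw [finrank_real_complex_pi] at hvol
  refine hvol.trans ?_
  gcongr
  exact_mod_cast hW

theorem exists_mul_volumeRate_le_entropyNumber_idC (hp : 0 < p) (hq : 0 < q) :
    ∃ c : ℝ, 0 < c ∧ ∀ n k : ℕ, 1 ≤ n → 1 ≤ k →
      c * volumeRate p q n k ≤ entropyNumber k (idC p q n) := by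
  obtain ⟨A, hA, hsup⟩ := exists_sup_cover hq
  refine ⟨A⁻¹, by positivity, fun n k hn hk =>
    le_entropyNumber_idC hp hq fun r hr Y hY hcover => ?_⟩
  have hn₀ : (0 : ℝ) < n := by exact_mod_cast hn
  have : Nonempty (Fin n) := ⟨⟨0, hn⟩⟩
  obtain ⟨Z, hZ, hZcover⟩ := hsup n hn
  set d := (n : ℝ) ^ (-(1 / p).toReal) with hd
  set e := (n : ℝ) ^ (-(1 / q).toReal) with he
  set τ := (2 : ℝ) ^ (-((k - 1 : ℝ) / (2 * n))) with hτ
  have hd₀ : 0 < d := by positivity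
  have he₀ : 0 < e := by positivity
  have hpow : (τ * d) ^ (2 * n) ≤ (A * (r * e)) ^ (2 * n) := by
    have hvol := card_rpow_neg_pow_le_of_cover hp hq hr he₀.le hcover hZcover
    rw [Fintype.card_fin, ← hd] at hvol
    calc (τ * d) ^ (2 * n) ≤ τ ^ (2 * n) * (2 ^ (k - 1) * A ^ (2 * n) * (r * e) ^ (2 * n)) := by
          rw [mul_pow]
          gcongr
          refine hvol.trans ?_
          gcongr
          · exact_mod_cast hY
          · exact hZ.trans (pow_le_pow_right₀ hA (by omega))
      _ = (A * (r * e)) ^ (2 * n) := by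
          linear_combination (A * (r * e)) ^ (2 * n) * two_rpow_neg_pow_mul_two_pow_pred hn hk
  have hle : τ * d ≤ A * (r * e) := le_of_pow_le_pow_left₀ (by omega) (by positivity) hpow
  calc A⁻¹ * volumeRate p q n k = A⁻¹ * (τ * d * e⁻¹) := by
        rw [volumeRate, ← hτ, sub_eq_neg_add, Real.rpow_add hn₀, ← hd, he, Real.rpow_neg hn₀.le,
          inv_inv, mul_assoc]
    _ ≤ A⁻¹ * (A * (r * e) * e⁻¹) := by gcongr
    _ = r := by field_simp

end Volume

theorem ncard_hammingDist_le {κ γ : Type*} [Fintype κ] [Fintype γ] [DecidableEq γ]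
    [Nonempty γ] (f : κ → γ) (d : ℕ) :
    {g : κ → γ | hammingDist f g ≤ d}.ncard ≤ 2 ^ Fintype.card κ * Fintype.card γ ^ d := by
  classical
  set B := Fintype.card γ
  have hB : (0 : ℝ) < B := by exact_mod_cast Fintype.card_pos
  let w : κ → γ → ℝ := fun i c => if f i = c then 0 else 1
  have hw (g : κ → γ) : ∑ i, w i (g i) = hammingDist f g := by
    simp only [w, hammingDist, Finset.card_filter, Nat.cast_sum, ne_eq, ite_not, Nat.cast_ite,
      Nat.cast_zero, Nat.cast_one]
  have hexp (i : κ) : ∑ c, Real.exp (-(Real.log B * w i c)) ≤ 2 := by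
    calc ∑ c, Real.exp (-(Real.log B * w i c))
        ≤ ∑ c, ((if f i = c then 1 else 0) + (B : ℝ)⁻¹) := by
          gcongr with c
          by_cases hc : f i = c
          · simp [w, hc]
          · simp [w, hc, Real.exp_neg, Real.exp_log hB]
      _ = 2 := by
          rw [Finset.sum_add_distrib, Finset.sum_ite_eq, if_pos (Finset.mem_univ _),
            Finset.sum_const, nsmul_eq_mul, Finset.card_univ, mul_inv_cancel₀ hB.ne',
            one_add_one_eq_two]
  have hcard := card_filter_sum_le_exp_mul_prod w (fun _ => Finset.univ)
    (Real.log_natCast_nonneg B) d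
  simp only [hw, Nat.cast_le, Fintype.piFinset_univ] at hcard
  rw [← Finset.coe_filter_univ, Set.ncard_coe_finset]
  have hle : Real.exp (Real.log B * d) * ∏ i, ∑ c, Real.exp (-(Real.log B * w i c)) ≤
      2 ^ Fintype.card κ * B ^ d := by
    rw [mul_comm (Real.log B), Real.exp_nat_mul, Real.exp_log hB, mul_comm]
    gcongr
    exact (Finset.prod_le_prod (fun _ _ => by positivity) fun i _ => hexp i).trans_eq (by simp)
  exact_mod_cast hcard.trans hle

section SparseCode

variable {p q : ℝ≥0∞} {ι κ γ : Type*} [Fintype κ]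

/-- The positions that encode a word `f : κ → γ` as a sparse set of coordinates: the coordinates
contain disjoint blocks `e (j, ·)`, one for each letter, and in the `j`-th block the one of `f j` is
marked. -/
def wordPosition (e : κ × γ ↪ ι) (f : κ → γ) : κ ↪ ι :=
  ⟨fun j => e (j, f j), fun _ _ h => congrArg Prod.fst (e.injective h)⟩

/-- The indicator of the positions marked by the word `f`, normalized in `ℓ_p`. -/
noncomputable def wordVector (p : ℝ≥0∞) (e : κ × γ ↪ ι) (f : κ → γ) : ι → ℂ :=
  ((Finset.univ.map (wordPosition e f) : Finset ι) : Set ι).indicator fun _ =>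
    (((Fintype.card κ : ℝ) ^ (-(1 / p).toReal) : ℝ) : ℂ)

theorem wordPosition_mem_map_iff (e : κ × γ ↪ ι) (f g : κ → γ) (j : κ) :
    wordPosition e f j ∈ Finset.univ.map (wordPosition e g) ↔ f j = g j := by
  rw [Finset.mem_map]
  constructor
  · rintro ⟨i, -, h⟩
    obtain ⟨rfl, h⟩ := Prod.mk.inj (e.injective h)
    exact h.symm
  · exact fun h => ⟨j, Finset.mem_univ j, congrArg (fun c => e (j, c)) h.symm⟩

variable [Fintype ι]

theorem norm_wordVector [Nonempty κ] (hp : 0 < p) (e : κ × γ ↪ ι) (f : κ → γ) :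
    ‖toLp p (wordVector p e f)‖ = 1 := by
  have hκ : (0 : ℝ) < Fintype.card κ := by exact_mod_cast Fintype.card_pos
  rw [wordVector, norm_toLp_indicator hp (Finset.map_nonempty.2 Finset.univ_nonempty),
    Finset.card_map, Finset.card_univ, Complex.norm_real, Real.norm_of_nonneg (by positivity),
    ← Real.rpow_add hκ, add_neg_cancel, Real.rpow_zero]

theorem hammingDist_rpow_mul_le_norm_sub [DecidableEq γ] (hq : 0 < q) (e : κ × γ ↪ ι)
    {f g : κ → γ} (hfg : f ≠ g) :
    (hammingDist f g : ℝ) ^ (1 / q).toReal * (Fintype.card κ : ℝ) ^ (-(1 / p).toReal) ≤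
      ‖toLp q (wordVector p e f - wordVector p e g)‖ := by
  classical
  set D := Finset.univ.filter fun j => f j ≠ g j
  set S : Finset ι := D.map (wordPosition e f)
  set c : ℝ := (Fintype.card κ : ℝ) ^ (-(1 / p).toReal)
  have hS : S.Nonempty := by
    obtain ⟨j, hj⟩ := Function.ne_iff.1 hfg
    exact Finset.map_nonempty.2 ⟨j, Finset.mem_filter.2 ⟨Finset.mem_univ j, hj⟩⟩
  have hnorm : ‖toLp q ((S : Set ι).indicator fun _ => c)‖ =
      (hammingDist f g : ℝ) ^ (1 / q).toReal * c := by
    rw [norm_toLp_indicator hq hS, Finset.card_map, Real.norm_of_nonneg (by positivity)]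
    rfl
  rw [← hnorm]
  refine norm_toLp_mono hq fun i => ?_
  by_cases hi : i ∈ S
  · obtain ⟨j, hj, rfl⟩ := Finset.mem_map.1 hi
    have hf : wordPosition e f j ∈ Finset.univ.map (wordPosition e f) :=
      (wordPosition_mem_map_iff e f f j).2 rfl
    have hg : wordPosition e f j ∉ Finset.univ.map (wordPosition e g) :=
      mt (wordPosition_mem_map_iff e f g j).1 (Finset.mem_filter.1 hj).2
    rw [Set.indicator_of_mem (Finset.mem_coe.2 hi), Pi.sub_apply, wordVector, wordVector,
      Set.indicator_of_mem (Finset.mem_coe.2 hf), Set.indicator_of_notMem (mt Finset.mem_coe.1 hg),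
      sub_zero, Complex.norm_real]
  · rw [Set.indicator_of_notMem (mt Finset.mem_coe.1 hi), norm_zero]
    positivity

theorem le_entropyNumber_idC_of_code (hp : 0 < p) (hq : 0 < q) {n k m B : ℕ} (hm : 1 ≤ m)
    (hB : 1 ≤ B) (hmB : m * B ≤ n) (hcard : 2 ^ (k - 1) * (2 ^ m * B ^ (m / 2)) < B ^ m) :
    (2 * 2 ^ (1 / q).toReal)⁻¹ * 2⁻¹ ^ (1 / q).toReal *
      (m : ℝ) ^ ((1 / q).toReal - (1 / p).toReal) ≤ entropyNumber k (idC p q n) := by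
  have hm₀ : (0 : ℝ) < m := by exact_mod_cast hm
  have : NeZero m := ⟨by omega⟩
  have : NeZero B := ⟨by omega⟩
  obtain ⟨e⟩ : Nonempty (Fin m × Fin B ↪ Fin n) :=
    Function.Embedding.nonempty_of_card_le (by simpa using hmB)
  have hnear (f : Fin m → Fin B) :
      {g | ‖toLp q (wordVector p e f - wordVector p e g)‖ <
        (2⁻¹ * m : ℝ) ^ (1 / q).toReal * (m : ℝ) ^ (-(1 / p).toReal)}.ncard ≤
          2 ^ m * B ^ (m / 2) := by
    have hball := ncard_hammingDist_le f (m / 2)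
    rw [Fintype.card_fin, Fintype.card_fin] at hball
    refine (Set.ncard_le_ncard (fun g hg => ?_) (Set.toFinite _)).trans hball
    by_contra hfar
    have hdist : m / 2 < hammingDist f g := not_le.1 hfar
    have hdist' : (2⁻¹ * m : ℝ) ≤ hammingDist f g := by
      have : (m : ℝ) ≤ 2 * hammingDist f g := by exact_mod_cast (by omega)
      linarith
    have hfg : f ≠ g := hammingDist_ne_zero.1 (by omega)
    have hsep := hammingDist_rpow_mul_le_norm_sub (p := p) hq e hfg
    rw [Fintype.card_fin] at hsep
    refine (Set.mem_ofPred_eq ▸ hg).not_ge (le_trans ?_ hsep)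
    gcongr
  refine le_trans (le_of_eq ?_) (le_entropyNumber_idC_of_card_near_le hp hq
    (fun f => (norm_wordVector hp e f).le) hnear (by simpa using hcard))
  rw [Real.mul_rpow (by positivity) hm₀.le, sub_eq_add_neg, Real.rpow_add hm₀]
  ring

end SparseCode

section UnitVectors

variable {p q : ℝ≥0∞}

theorem le_entropyNumber_idC_of_two_pow_le (hp : 0 < p) (hq : 0 < q) {n k : ℕ}
    (hk : 2 ^ (k - 1) ≤ n) : (2 * 2 ^ (1 / q).toReal)⁻¹ ≤ entropyNumber k (idC p q n) := by
  let x : Option (Fin n) → Fin n → ℂ := fun o => (o.toFinset : Set (Fin n)).indicator fun _ => 1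
  have hx (o : Option (Fin n)) : ‖toLp p (x o)‖ ≤ 1 := by
    rcases o with _ | i
    · exact (norm_toLp_le_card_rpow_mul hp _).trans (by simp [x, ← Pi.zero_def])
    · have h := norm_toLp_indicator hp (Finset.singleton_nonempty i) (1 : ℂ)
      rw [Finset.card_singleton, Nat.cast_one, Real.one_rpow, norm_one, one_mul] at h
      exact h.le
  have hsep {o o' : Option (Fin n)} (h : o ≠ o') : 1 ≤ ‖toLp q (x o - x o')‖ := by
    suffices ∃ i, 1 ≤ ‖(x o - x o') i‖ by
      obtain ⟨i, hi⟩ := this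
      exact hi.trans ((norm_le_pi_norm _ i).trans (norm_le_norm_toLp hq _))
    rcases o with _ | i <;> rcases o' with _ | j
    · exact absurd rfl h
    · exact ⟨j, by simp [x]⟩
    · exact ⟨i, by simp [x]⟩
    · have hij : i ≠ j := fun hij => h (congrArg some hij)
      exact ⟨i, by simp [x, hij]⟩
  have hnear (o : Option (Fin n)) : {o' | ‖toLp q (x o - x o')‖ < 1}.ncard ≤ 1 :=
    (Set.ncard_le_one_iff_subset_singleton (Set.toFinite _)).2
      ⟨o, fun o' h => by_contra fun h' => (hsep (Ne.symm h')).not_gt h⟩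
  simpa using le_entropyNumber_idC_of_card_near_le hp hq hx hnear (by simpa using by omega)

end UnitVectors

section LowerBounds

variable {p q : ℝ≥0∞}

/-- Words of length `m` over an alphabet of size `2 ^ b ≈ n / k`, with `b * m ≈ 4 * k` so that the
`2 ^ (b * m)` words outnumber the balls even after division by the size of a Hamming ball. -/
theorem exists_code_parameters {n k : ℕ} (hnk : 32 * k ≤ n) (hk : 1 ≤ k) (h : 2 * n ≤ 2 ^ k) :
    ∃ m b : ℕ, 1 ≤ m ∧ 4 ≤ b ∧ m * 2 ^ b ≤ n ∧ 4 * k ≤ b * m ∧ b * m ≤ 5 * k ∧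
      n < 2 ^ (b + 2) * k := by
  obtain ⟨b, hb⟩ : ∃ b, Nat.log 2 (n / k) = b + 5 := by
    refine Nat.exists_eq_add_of_le' (Nat.le_log_of_pow_le one_lt_two ?_)
    exact (Nat.le_div_iff_mul_le hk).2 hnk
  have hdiv : n / k ≠ 0 := (Nat.div_pos (by omega) hk).ne'
  have hlower : 2 ^ (b + 5) * k ≤ n :=
    (Nat.le_div_iff_mul_le hk).1 (hb ▸ Nat.pow_log_le_self 2 hdiv)
  have hupper : n < 2 ^ (b + 6) * k := by
    refine (Nat.div_lt_iff_lt_mul hk).1 ?_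
    simpa only [hb] using Nat.lt_pow_succ_log_self one_lt_two (n / k)
  have hbk : b + 6 ≤ k := by
    rw [← Nat.pow_le_pow_iff_right one_lt_two]
    calc 2 ^ (b + 6) = 2 * 2 ^ (b + 5) := pow_succ' 2 (b + 5)
      _ ≤ 2 * (2 ^ (b + 5) * k) := by gcongr; exact Nat.le_mul_of_pos_right _ hk
      _ ≤ 2 * n := by gcongr
      _ ≤ 2 ^ k := h
  have hm : 4 * k / (b + 4) ≤ k := Nat.div_le_of_le_mul (by gcongr; omega)
  have hmul : (b + 4) * (4 * k / (b + 4)) ≤ 4 * k := Nat.mul_div_le _ _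
  refine ⟨4 * k / (b + 4) + 1, b + 4, Nat.le_add_left 1 _, by omega, ?_,
    (Nat.lt_mul_div_succ _ (by omega)).le, by rw [mul_add_one]; omega, hupper⟩
  calc (4 * k / (b + 4) + 1) * 2 ^ (b + 4) ≤ 2 * k * 2 ^ (b + 4) := by gcongr; omega
    _ = 2 ^ (b + 5) * k := by ring
    _ ≤ n := hlower

theorem code_card_lt {k m b : ℕ} (hk : 1 ≤ k) (hb : 4 ≤ b) (hbm : 4 * k ≤ b * m) :
    2 ^ (k - 1) * (2 ^ m * (2 ^ b) ^ (m / 2)) < (2 ^ b) ^ m := by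
  have hm : 4 * m ≤ b * m := Nat.mul_le_mul_right m hb
  have hhalf : 2 * (b * (m / 2)) ≤ b * m := by
    rw [mul_left_comm]
    exact Nat.mul_le_mul_left b (Nat.mul_div_le m 2)
  rw [← pow_mul, ← pow_mul, ← pow_add, ← pow_add]
  exact Nat.pow_lt_pow_right one_lt_two (by omega)

theorem logRate_le_of_mul_logb_le {n k : ℕ} {t D : ℝ} (hp : 0 < p) (hpq : p ≤ q) (hk : 1 ≤ k)
    (ht : 0 < t) (hD : 0 ≤ D) (h : t * Real.logb 2 (1 + 2 * n / k) ≤ D * k) :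
    logRate p q n k ≤
      D ^ ((1 / p).toReal - (1 / q).toReal) * t ^ ((1 / q).toReal - (1 / p).toReal) := by
  have hk₀ : (0 : ℝ) < k := by exact_mod_cast hk
  have hL : 0 ≤ Real.logb 2 (1 + 2 * n / k) :=
    Real.logb_nonneg one_lt_two (le_add_of_nonneg_right (by positivity))
  rw [logRate, ← neg_sub (1 / p).toReal, Real.rpow_neg ht.le, ← Real.inv_rpow ht.le,
    ← Real.mul_rpow hD (by positivity), ← div_eq_mul_inv]
  refine Real.rpow_le_rpow (by positivity) ?_ (sub_nonneg.2 (toReal_one_div_anti hp hpq))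
  rw [div_le_div_iff₀ hk₀ ht]
  linarith

theorem logb_two_one_add_two_mul_div_le {n k b : ℕ} (hk : 1 ≤ k) (h : n ≤ 2 ^ b * k) :
    Real.logb 2 (1 + 2 * n / k) ≤ b + 2 := by
  have hk₀ : (0 : ℝ) < k := by exact_mod_cast hk
  have hdiv : (n : ℝ) / k ≤ 2 ^ b := (div_le_iff₀ hk₀).2 (by exact_mod_cast h)
  rw [Real.logb_le_iff_le_rpow one_lt_two (by positivity)]
  norm_cast
  push_cast
  rw [mul_div_assoc, pow_add]
  linarith [one_le_pow₀ (M₀ := ℝ) one_le_two (n := b)]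

theorem exists_mul_rpow_le_entropyNumber_idC_of_code (hp : 0 < p) (hq : 0 < q) {n k : ℕ}
    (hk : 1 ≤ k) (hnk : 32 * k ≤ n) (hlog : 2 * n ≤ 2 ^ k) :
    ∃ m : ℕ, 1 ≤ m ∧ m * Real.logb 2 (1 + 2 * n / k) ≤ 10 * k ∧
      (2 * 2 ^ (1 / q).toReal)⁻¹ * 2⁻¹ ^ (1 / q).toReal *
        (m : ℝ) ^ ((1 / q).toReal - (1 / p).toReal) ≤ entropyNumber k (idC p q n) := by
  obtain ⟨m, b, hm, hb, hmb, hbm, hbm', hn⟩ := exists_code_parameters hnk hk hlog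
  refine ⟨m, hm, ?_, le_entropyNumber_idC_of_code hp hq hm Nat.one_le_two_pow hmb
    (code_card_lt hk hb hbm)⟩
  have hb' : (4 : ℝ) ≤ b := by exact_mod_cast hb
  have hL := logb_two_one_add_two_mul_div_le hk hn.le
  calc m * Real.logb 2 (1 + 2 * n / k) ≤ m * (2 * b) := by
        gcongr
        push_cast at hL
        linarith
    _ = 2 * (b * m : ℕ) := by push_cast; ring
    _ ≤ 2 * (5 * k : ℕ) := by gcongr
    _ = 10 * k := by push_cast; ring

theorem half_mul_rpow_le_volumeRate {n k : ℕ} (hn : 1 ≤ n) (hkn : k ≤ 2 * n) :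
    2⁻¹ * (n : ℝ) ^ ((1 / q).toReal - (1 / p).toReal) ≤ volumeRate p q n k := by
  have hkn' : (k : ℝ) ≤ 2 * n := by exact_mod_cast hkn
  have hexp : ((k : ℝ) - 1) / (2 * n) ≤ 1 := (div_le_one (by positivity)).2 (by linarith)
  rw [volumeRate]
  gcongr
  rw [← Real.rpow_neg_one]
  exact Real.rpow_le_rpow_of_exponent_le one_le_two (neg_le_neg hexp)

theorem exists_mul_logRate_le_entropyNumber_idC (hp : 0 < p) (hpq : p ≤ q) :
    ∃ c : ℝ, 0 < c ∧ ∀ n k : ℕ, 1 ≤ n → 1 ≤ k → 2 * n ≤ 2 ^ k → k ≤ 2 * n →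
      c * logRate p q n k ≤ entropyNumber k (idC p q n) := by
  have hq : 0 < q := hp.trans_le hpq
  obtain ⟨c₁, hc₁, hvol⟩ := exists_mul_volumeRate_le_entropyNumber_idC hp hq
  set c₂ : ℝ := (2 * 2 ^ (1 / q).toReal)⁻¹ * 2⁻¹ ^ (1 / q).toReal
  set γ := (1 / p).toReal - (1 / q).toReal
  have hc₂ : 0 < c₂ := by positivity
  refine ⟨min (c₁ / 2) c₂ * (224 ^ γ)⁻¹, by positivity, fun n k hn hk hlog hkn => ?_⟩
  obtain ⟨m, hm, hmL, hle⟩ : ∃ m : ℕ, 1 ≤ m ∧ m * Real.logb 2 (1 + 2 * n / k) ≤ 224 * k ∧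
      min (c₁ / 2) c₂ * (m : ℝ) ^ ((1 / q).toReal - (1 / p).toReal) ≤
        entropyNumber k (idC p q n) := by
    rcases le_total (32 * k) n with hnk | hnk
    · obtain ⟨m, hm, hmL, hle⟩ := exists_mul_rpow_le_entropyNumber_idC_of_code hp hq hk hnk hlog
      exact ⟨m, hm, hmL.trans (by gcongr; norm_num),
        le_trans (by gcongr; exact min_le_right _ _) hle⟩
    · refine ⟨n, hn, ?_, ?_⟩
      · have hL := logb_two_one_add_two_mul_div_le (b := 5) hk hnk
        have hnk' : (n : ℝ) ≤ 32 * k := by exact_mod_cast hnk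
        push_cast at hL
        nlinarith
      · calc min (c₁ / 2) c₂ * (n : ℝ) ^ ((1 / q).toReal - (1 / p).toReal)
            ≤ c₁ / 2 * (n : ℝ) ^ ((1 / q).toReal - (1 / p).toReal) := by
              gcongr
              exact min_le_left _ _
          _ = c₁ * (2⁻¹ * (n : ℝ) ^ ((1 / q).toReal - (1 / p).toReal)) := by ring
          _ ≤ c₁ * volumeRate p q n k := by
              gcongr
              exact half_mul_rpow_le_volumeRate hn hkn
          _ ≤ entropyNumber k (idC p q n) := hvol n k hn hk
  calc min (c₁ / 2) c₂ * (224 ^ γ)⁻¹ * logRate p q n k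
      ≤ min (c₁ / 2) c₂ * (224 ^ γ)⁻¹ * (224 ^ γ *
          (m : ℝ) ^ ((1 / q).toReal - (1 / p).toReal)) := by
        gcongr
        exact logRate_le_of_mul_logb_le hp hpq hk (by exact_mod_cast hm) (by norm_num) hmL
    _ = min (c₁ / 2) c₂ * (m : ℝ) ^ ((1 / q).toReal - (1 / p).toReal) := by field_simp
    _ ≤ entropyNumber k (idC p q n) := hle

end LowerBounds

section Regimes

variable {n k : ℕ}

theorem two_pow_pred_le_of_le_logb (hn : 1 ≤ n) (hk : 1 ≤ k) (h : (k : ℝ) ≤ Real.logb 2 (2 * n)) :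
    2 ^ (k - 1) ≤ n := by
  rw [Real.le_logb_iff_rpow_le one_lt_two (by positivity), Real.rpow_natCast,
    ← Nat.sub_add_cancel hk, pow_succ'] at h
  exact_mod_cast le_of_mul_le_mul_left h two_pos

theorem two_mul_le_two_pow_of_logb_le (hn : 1 ≤ n) (h : Real.logb 2 (2 * n) ≤ k) :
    2 * n ≤ 2 ^ k := by
  rw [Real.logb_le_iff_le_rpow one_lt_two (by positivity), Real.rpow_natCast] at h
  exact_mod_cast h

end Regimes

theorem mainTheorem2 (p q : ℝ≥0∞) (hp : 0 < p) (hq : 0 < q) :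
    (p ≤ q → ∃ c C : ℝ, 0 < c ∧ 0 < C ∧ ∀ n k : ℕ, 1 ≤ n → 1 ≤ k →
      ((k : ℝ) ≤ Real.logb 2 (2 * n) →
        c ≤ entropyNumber k (idC p q n) ∧ entropyNumber k (idC p q n) ≤ C) ∧
      (Real.logb 2 (2 * n) ≤ k → (k : ℝ) ≤ 2 * n →
        c * (Real.logb 2 (1 + 2 * n / k) / k) ^ ((1 / p).toReal - (1 / q).toReal)
            ≤ entropyNumber k (idC p q n) ∧
          entropyNumber k (idC p q n)
            ≤ C * (Real.logb 2 (1 + 2 * n / k) / k) ^ ((1 / p).toReal - (1 / q).toReal)) ∧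
      ((2 * n : ℝ) ≤ k →
        c * ((2 : ℝ) ^ (-((k - 1 : ℝ) / (2 * n))) * (n : ℝ) ^ ((1 / q).toReal - (1 / p).toReal))
            ≤ entropyNumber k (idC p q n) ∧
          entropyNumber k (idC p q n)
            ≤ C * ((2 : ℝ) ^ (-((k - 1 : ℝ) / (2 * n))) *
                (n : ℝ) ^ ((1 / q).toReal - (1 / p).toReal)))) ∧
    (q ≤ p → ∃ c C : ℝ, 0 < c ∧ 0 < C ∧ ∀ n k : ℕ, 1 ≤ n → 1 ≤ k →
      c * ((2 : ℝ) ^ (-((k - 1 : ℝ) / (2 * n))) * (n : ℝ) ^ ((1 / q).toReal - (1 / p).toReal))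
          ≤ entropyNumber k (idC p q n) ∧
        entropyNumber k (idC p q n)
          ≤ C * ((2 : ℝ) ^ (-((k - 1 : ℝ) / (2 * n))) *
              (n : ℝ) ^ ((1 / q).toReal - (1 / p).toReal))) := by
  obtain ⟨c₁, hc₁, hvol⟩ := exists_mul_volumeRate_le_entropyNumber_idC hp hq
  refine ⟨fun hpq => ?_, fun hqp => ?_⟩
  · obtain ⟨c₂, hc₂, hlog⟩ := exists_mul_logRate_le_entropyNumber_idC hp hpq
    obtain ⟨C₁, hC₁, hvol'⟩ := exists_entropyNumber_idC_le_volumeRate_of_two_mul_le hp hpq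
    obtain ⟨C₂, hC₂, hlog'⟩ := exists_entropyNumber_idC_le_logRate hp hpq
    refine ⟨min (2 * 2 ^ (1 / q).toReal)⁻¹ (min c₁ c₂), max C₁ C₂, by positivity, by positivity,
      fun n k hn hk => ⟨fun hkn => ⟨?_, ?_⟩, fun hnk hkn => ?_, fun hnk => ?_⟩⟩
    · exact (min_le_left _ _).trans
        (le_entropyNumber_idC_of_two_pow_le hp hq (two_pow_pred_le_of_le_logb hn hk hkn))
    · exact (entropyNumber_idC_le_one hp hpq n k).trans (hC₂.trans (le_max_right _ _))
    · have hkn' : k ≤ 2 * n := by exact_mod_cast hkn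
      have hrate := logRate_nonneg p q n k
      exact ⟨(mul_le_mul_of_nonneg_right ((min_le_right _ _).trans (min_le_right _ _)) hrate).trans
          (hlog n k hn hk (two_mul_le_two_pow_of_logb_le hn hnk) hkn'),
        (hlog' n k hk hkn').trans (mul_le_mul_of_nonneg_right (le_max_right _ _) hrate)⟩
    · have hrate := (volumeRate_pos p q hn (k := k)).le
      exact ⟨(mul_le_mul_of_nonneg_right ((min_le_right _ _).trans (min_le_left _ _)) hrate).trans
          (hvol n k hn hk),
        (hvol' n k hn (by exact_mod_cast hnk)).trans
          (mul_le_mul_of_nonneg_right (le_max_left _ _) hrate)⟩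
  · obtain ⟨C, hC, hvol'⟩ := exists_entropyNumber_idC_le_volumeRate hq hqp
    exact ⟨c₁, C, hc₁, hC, fun n k hn hk => ⟨hvol n k hn hk, hvol' n k hn hk⟩⟩
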